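/- Let $n\ge 1$ and $d>n$ be integers. Let $N+1=\binom{n+1+d}{d}$ and let $\mathcal X\subset\mathbb P^{n+1}\times\mathbb P^{N}$ (over $\mathbb C$) be the universal hypersurface of degree $d$, defined by $\sum_{|\alpha|=d}A_\alpha Z^\alpha=0$. Let $J^n_{\rm vert}(\mathcal X)\subset J^n(\mathbb C,\mathbb P^{n+1})\times\mathbb P^N$ be the space of vertical $n$-jets: the pairs $(j,[A])$, where $j$ is the $n$-jet at $0$ of a holomorphic curve in $\mathbb P^{n+1}$ such that, for a local lift $Z(\zeta)\in\mathbb C^{n+2}\setminus\{0\}$, the function $\sum_\alpha A_\alpha Z(\zeta)^\alpha$ and its first $n$ derivatives in $\zeta$ (with the $A_\alpha$ constant) vanish at $\zeta=0$. On the affine chart $\{Z_0\ne0\}\times\{A_{0d0\cdots0}\neq 0\}$ use the jet coordinates $z_i^{(\lambda)}$, the derivatives of $z_i=Z_i/Z_0$ ($1\le i\le n+1$, $0\le\lambda\le n$). Let $\Sigma_0$ be the set of the vertical jets in this chart at which all $n\times n$ Wronskian determinants $\det\big(z_{r_i}^{(\lambda_j)}\big)_{1\le i,j\le n}$, with $1\le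 r_i\le n+1$ and $1\le\lambda_j\le n$, vanish, and let $\Sigma$ be the closure of $\Sigma_0$ in $J^n_{\rm vert}(\mathcal X)$. Then at every point of $J^n_{\rm vert}(\mathcal X)\setminus\Sigma$ the space $J^n_{\rm vert}(\mathcal X)$ is smooth of codimension $n+1$ in $J^n(\mathbb C,\mathbb P^{n+1})\times\mathbb P^N$ (its $n+1$ defining equations have linearly independent differentials there), and the twisted tangent bundle $$T_{J^n_{\rm vert}(\mathcal X)}\otimes\mathcal O_{\mathbb P^{n+1}}\Big(\tfrac{n^2+5n}{2}\Big)\otimes\mathcal O_{\mathbb P^N}(1)$$ is generated by its global sections, that is, by the values of algebraic (in particular holomorphic) sections defined over all of $J^n_{\rm vert}(\mathcal X)$. The twisting order $\frac{n^2+5n}{2}$ equals $7$ for $n=2$ and $12$ for $n=3$. -/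

import Mathlib

open scoped PowerSeries

noncomputable section

/-- Multi-indices `α ∈ ℕ^{n+2}` of length `α_0 + ⋯ + α_{n+1} = d`; they label the homogeneous
coordinates `A_α` of the projective space `ℙ^N` of degree `d` hypersurfaces of `ℙ^{n+1}`. -/
abbrev MultiIdx (n d : ℕ) : Type :=
  ↥(Finset.piAntidiag (Finset.univ : Finset (Fin (n + 2))) d)

/-- Labels of the homogeneous coordinates on `J^n(ℂ, ℙ^{n+1}) × ℙ^N`: `inl (i, k)` is the `k`-th
Taylor coefficient `Z_i^{(k)} / k!` of the `i`-th component of a lift `Z(ζ)` to `ℂ^{n+2}` of a curve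
in `ℙ^{n+1}`, and `inr α` is the coefficient `A_α` of the hypersurface. -/
abbrev CoordIdx (n d : ℕ) : Type := (Fin (n + 2) × Fin (n + 1)) ⊕ MultiIdx n d

/-- The vector space of the homogeneous coordinates `(Z, Z', …, Z^{(n)}, A)`. -/
abbrev Coord (n d : ℕ) : Type := CoordIdx n d → ℂ

variable {n d : ℕ}

/-- The `i`-th component `Z_i(ζ) = ∑_{k ≤ n} x_{i,k} ζ^k` of the lifted jet. -/
def jetSeries (x : Coord n d) (i : Fin (n + 2)) : ℂ⟦X⟧ :=
  PowerSeries.mk fun k => if h : k < n + 1 then x (Sum.inl (i, ⟨k, h⟩)) else 0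

/-- The series `∑_{|α| = d} A_α Z(ζ)^α`. -/
def universalSeries (x : Coord n d) : ℂ⟦X⟧ :=
  ∑ α : MultiIdx n d, PowerSeries.C (x (Sum.inr α)) * ∏ i, jetSeries x i ^ (α.1 i)

/-- The `κ`-th defining function (up to the factor `κ!`) of the space of vertical jets: the `κ`-th
Taylor coefficient of `∑_α A_α Z(ζ)^α`, i.e. the `κ`-th total derivative of the universal equation,
the `A_α` being held constant. -/
def vertEqn (κ : Fin (n + 1)) (x : Coord n d) : ℂ :=
  PowerSeries.coeff (κ : ℕ) (universalSeries x)

/-- The action on homogeneous coordinates `(Z(ζ), A) ↦ (f(ζ) Z(ζ) mod ζ^{n+1}, μ A)`. -/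
def scale (f : ℂ⟦X⟧) (μ : ℂ) (x : Coord n d) : Coord n d
  | Sum.inl (i, k) => PowerSeries.coeff (k : ℕ) (f * jetSeries x i)
  | Sum.inr α => μ * x (Sum.inr α)

/-- Homogeneous coordinates of the vertical `n`-jets of the universal hypersurface: `Z(0) ≠ 0`,
`A ≠ 0`, and the jet is contained to order `n` in the hypersurface `∑ A_α Z^α = 0`. -/
def VertCone (n d : ℕ) : Type :=
  {x : Coord n d // (∃ i, x (Sum.inl (i, 0)) ≠ 0) ∧ (∃ α, x (Sum.inr α) ≠ 0) ∧
    ∀ κ : Fin (n + 1), vertEqn κ x = 0}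

instance : TopologicalSpace (VertCone n d) :=
  inferInstanceAs (TopologicalSpace (Subtype _))

theorem coeff_jetSeries (x : Coord n d) (i : Fin (n + 2)) (k : Fin (n + 1)) :
    PowerSeries.coeff (k : ℕ) (jetSeries x i) = x (Sum.inl (i, k)) := by
  rw [jetSeries, PowerSeries.coeff_mk, dif_pos k.2]

theorem scale_one (x : Coord n d) : scale 1 1 x = x := by
  funext j
  rcases j with ⟨i, k⟩ | α
  · simp [scale, coeff_jetSeries]
  · simp [scale]

theorem scale_scale (g f : ℂ⟦X⟧) (ν μ : ℂ) (x : Coord n d) :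
    scale g ν (scale f μ x) = scale (g * f) (ν * μ) x := by
  funext j
  rcases j with ⟨i, k⟩ | α
  · simp only [scale, mul_assoc g f]
    rw [PowerSeries.coeff_mul, PowerSeries.coeff_mul]
    refine Finset.sum_congr rfl fun p hp => ?_
    have hp2 : p.2 < n + 1 := by
      have := Finset.HasAntidiagonal.mem_antidiagonal.mp hp
      have := k.2
      omega
    have := coeff_jetSeries (scale f μ x) i ⟨p.2, hp2⟩
    simp only [scale] at this
    rw [this]
  · simp [scale, mul_assoc]

theorem scale_add (f g : ℂ⟦X⟧) (μ ν : ℂ) (x : Coord n d) :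
    scale f μ x + scale g ν x = scale (f + g) (μ + ν) x := by
  funext j
  rcases j with ⟨i, k⟩ | α <;> simp [scale, add_mul]

theorem smul_scale (c : ℂ) (f : ℂ⟦X⟧) (μ : ℂ) (x : Coord n d) :
    c • scale f μ x = scale (c • f) (c * μ) x := by
  funext j
  rcases j with ⟨i, k⟩ | α <;> simp [scale, mul_assoc]

/-- Two systems of homogeneous coordinates define the same vertical jet when they differ by an
invertible `n`-jet of function `f(ζ)` (a change of lift of the curve) and a scalar `μ ≠ 0`. -/
instance vertSetoid (n d : ℕ) : Setoid (VertCone n d) where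
  r x y := ∃ (f : ℂ⟦X⟧) (μ : ℂ), PowerSeries.constantCoeff f ≠ 0 ∧ μ ≠ 0 ∧
    y.1 = scale f μ x.1
  iseqv :=
    { refl := fun x => ⟨1, 1, by simp, one_ne_zero, (scale_one x.1).symm⟩
      symm := by
        rintro x y ⟨f, μ, hf, hμ, h⟩
        refine ⟨f⁻¹, μ⁻¹, by simpa using hf, inv_ne_zero hμ, ?_⟩
        rw [h, scale_scale, PowerSeries.inv_mul_cancel f hf, inv_mul_cancel₀ hμ, scale_one]
      trans := by
        rintro x y z ⟨f, μ, hf, hμ, h⟩ ⟨g, ν, hg, hν, h'⟩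
        exact ⟨g * f, ν * μ, by simpa using ⟨hg, hf⟩, mul_ne_zero hν hμ, by
          rw [h', h, scale_scale]⟩ }

/-- The space `J^n_vert(𝒳)` of vertical `n`-jets of the universal hypersurface
`𝒳 ⊂ ℙ^{n+1} × ℙ^N` of degree `d`, with its classical (quotient) topology. -/
def VertJet (n d : ℕ) : Type := Quotient (vertSetoid n d)

instance : TopologicalSpace (VertJet n d) :=
  inferInstanceAs (TopologicalSpace (Quotient (vertSetoid n d)))

/-- The vertical jet with given homogeneous coordinates. -/
def VertJet.mk (x : VertCone n d) : VertJet n d := Quotient.mk (vertSetoid n d) x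

/-- The multi-index `(0, d, 0, …, 0)`. -/
def leadIdx (n d : ℕ) : MultiIdx n d :=
  ⟨Pi.single 1 d, by simp [Finset.mem_piAntidiag]⟩

/-- Normalized coordinates of a jet in the affine chart `{Z_0 ≠ 0} × {A_{0d0⋯0} ≠ 0}`: the lift is
`Z(ζ) = (1, z_1(ζ), …, z_{n+1}(ζ))`, and `A_{0d0⋯0} = 1`. -/
def IsAffine (x : Coord n d) : Prop :=
  (∀ k : Fin (n + 1), x (Sum.inl (0, k)) = if k = 0 then 1 else 0) ∧
    x (Sum.inr (leadIdx n d)) = 1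

/-- The derivative `Z_i^{(k)}`, i.e. `z_i^{(k)}` for `i ≥ 1` in normalized affine coordinates. -/
def jetDeriv (x : Coord n d) (i : Fin (n + 2)) (k : Fin (n + 1)) : ℂ :=
  (Nat.factorial k : ℂ) * x (Sum.inl (i, k))

/-- The set `Σ_0` of the vertical affine jets all of whose `n × n` Wronskians
`det (z_{r_i}^{(λ_j)})`, `1 ≤ r_i ≤ n + 1`, `1 ≤ λ_j ≤ n`, vanish. -/
def affineBadSet (n d : ℕ) : Set (VertJet n d) :=
  {p | ∃ x : VertCone n d, VertJet.mk x = p ∧ IsAffine x.1 ∧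
    ∀ (r : Fin n → Fin (n + 1)) (l : Fin n → Fin n),
      (Matrix.of fun i j => jetDeriv x.1 (r i).succ (l j).succ).det = 0}

/-- The exceptional set `Σ`, the closure of `Σ_0` in `J^n_vert(𝒳)`. -/
def badSet (n d : ℕ) : Set (VertJet n d) := closure (affineBadSet n d)

/-- The tangent space at `x` of the orbit of `x` under `(f, μ) ↦ scale f μ x`: as the action is
linear in `(f, μ)`, it consists of all `(f Z, μ A)`. The tangent space of
`J^n(ℂ, ℙ^{n+1}) × ℙ^N` at the point with homogeneous coordinates `x` is `Coord n d ⧸ orbitTangent x`. -/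
def orbitTangent (x : Coord n d) : Submodule ℂ (Coord n d) where
  carrier := {v | ∃ (f : ℂ⟦X⟧) (μ : ℂ), v = scale f μ x}
  add_mem' := by
    rintro _ _ ⟨f, μ, rfl⟩ ⟨g, ν, rfl⟩
    exact ⟨f + g, μ + ν, scale_add f g μ ν x⟩
  zero_mem' := ⟨0, 0, by funext j; rcases j with ⟨i, k⟩ | α <;> simp [scale]⟩
  smul_mem' := by
    rintro c _ ⟨f, μ, rfl⟩
    exact ⟨c • f, c * μ, smul_scale c f μ x⟩

/-- The tangent space of `J^n_vert(𝒳)` at the point with homogeneous coordinates `x`: the common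
kernel of the differentials of the defining functions, modulo the tangent space of the orbit.
The coordinates `x` also trivialize the fibre of `𝒪(c) ⊗ 𝒪(c')` at this point, so that this is
the fibre of the twisted tangent bundle as well. -/
def tangentFibre (x : VertCone n d) : Submodule ℂ (Coord n d ⧸ orbitTangent x.1) :=
  (⨅ κ : Fin (n + 1), LinearMap.ker (fderiv ℂ (vertEqn (n := n) (d := d) κ) x.1).toLinearMap).map
    (orbitTangent x.1).mkQ

/-- The `n + 1` defining functions of `J^n_vert(𝒳)` have linearly independent differentials at `x`,
that is, `J^n_vert(𝒳)` is smooth of codimension `n + 1` in `J^n(ℂ, ℙ^{n+1}) × ℙ^N` there. -/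
def SmoothAt (x : VertCone n d) : Prop :=
  LinearIndependent ℂ
    fun κ : Fin (n + 1) => fderiv ℂ (vertEqn (n := n) (d := d) κ) x.1

/-- Global (algebraic) sections over `J^n_vert(𝒳)` of
`T_{J^n_vert(𝒳)} ⊗ 𝒪_{ℙ^{n+1}}(c) ⊗ 𝒪_{ℙ^N}(c')`, written in homogeneous coordinates. -/
structure IsGlobalSection (c c' : ℕ)
    (s : (x : VertCone n d) → Coord n d ⧸ orbitTangent x.1) : Prop where
  /-- The values are tangent to `J^n_vert(𝒳)`. -/
  tangent : ∀ x, s x ∈ tangentFibre x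
  /-- The section descends to `J^n_vert(𝒳)`: under a change `(f, μ)` of homogeneous coordinates,
  tangent vectors are transported by the (linear) action, and the twist `𝒪(c) ⊗ 𝒪(c')` contributes
  the character `f(0)^c μ^{c'}`. -/
  equivariant : ∀ (x y : VertCone n d) (f : ℂ⟦X⟧) (μ : ℂ),
    PowerSeries.constantCoeff f ≠ 0 → μ ≠ 0 → y.1 = scale f μ x.1 →
    ∀ w : Coord n d, s x = (orbitTangent x.1).mkQ w →
      s y = (orbitTangent y.1).mkQ ((PowerSeries.constantCoeff f ^ c * μ ^ c') • scale f μ w)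
  /-- The section is regular: locally (in the Zariski topology) it is a vector of polynomials
  in the homogeneous coordinates divided by a nowhere vanishing polynomial. -/
  regular : ∀ x : VertCone n d, ∃ (Q : MvPolynomial (CoordIdx n d) ℂ)
    (P : CoordIdx n d → MvPolynomial (CoordIdx n d) ℂ),
    MvPolynomial.eval x.1 Q ≠ 0 ∧ ∀ y : VertCone n d, MvPolynomial.eval y.1 Q ≠ 0 →
      MvPolynomial.eval y.1 Q • s y =
        (orbitTangent y.1).mkQ fun j => MvPolynomial.eval y.1 (P j)

/-- `T_{J^n_vert(𝒳)} ⊗ 𝒪_{ℙ^{n+1}}(c) ⊗ 𝒪_{ℙ^N}(c')` is generated by its global sections at the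
point with homogeneous coordinates `x`: their values span the fibre. -/
def GloballyGeneratedAt (c c' : ℕ) (x : VertCone n d) : Prop :=
  Submodule.span ℂ {w | ∃ s, IsGlobalSection c c' s ∧ s x = w} = tangentFibre x

/-- The twisting order `(n² + 5n)/2` in the `ℙ^{n+1}`-direction (`n² + 5n` is even). -/
def poleOrder (n : ℕ) : ℕ := (n ^ 2 + 5 * n) / 2

end

noncomputable section

open MvPolynomial (aeval IsHomogeneous pderiv)

variable {n d : ℕ}

/-! Work in the ring of jets modulo ζ^{n+1}. Verticality is then one equation F(Z) = 0 there, and a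
change of lift multiplies the jet of a form of degree e by f^e. A jet is nondegenerate (`IsNondeg`)
when linear forms, evaluated on it, fill the jet ring. Both conclusions hold at nondegenerate jets,
and all degenerate ones lie in Σ.

At a nondegenerate jet some linear form l has jet 1, so forms of every positive degree fill the jet
ring. Moving only the hypersurface then gives a family dual to the differentials, hence smoothness.
For generation, a suitable element of gl_{n+2} reproduces the jet component of a tangent vector, and
subtracting its linear field leaves a form P of degree d vanishing on the jet. Modulo quadrics
vanishing on the jet, a product of two linear forms becomes l times a linear form. Induction with
Euler's identity (`exists_linear_reduction`) brings P to l^{d-1} m, where m also vanishes on the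
jet. So multiples of linear and quadratic forms vanishing on the jet suffice.

Cramer's rule extends such a form of degree e to a polynomial family of forms, each vanishing on its
own jet, of weight e(n+1) (`mul_mem_sectionSpan`). For e = 2 this fits in the twist when n ≥ 2. For
n = 1 products of two linear forms vanishing at the base point, of weight 2, replace it.

A degenerate jet in the affine chart has vanishing Wronskians, so it lies in Σ_0. Any other one is a
limit of such jets: a line of matrices starting at the identity moves jet and equation together,
preserves verticality and degeneracy, and enters the chart for small t ≠ 0 (`mk_mem_badSet`). -/

/-! ### The ring of jets of functions. -/

/-- The ring `ℂ⟦ζ⟧ / (ζ^{n+1})` of `n`-jets of functions at `0`. -/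
abbrev JetRing (n : ℕ) : Type := ℂ⟦X⟧ ⧸ Ideal.span {(PowerSeries.X : ℂ⟦X⟧) ^ (n + 1)}

/-- The `n`-jet of a power series. -/
def jetMk (n : ℕ) : ℂ⟦X⟧ →ₐ[ℂ] JetRing n := Ideal.Quotient.mkₐ ℂ _

theorem jetMk_eq_iff {a b : ℂ⟦X⟧} :
    jetMk n a = jetMk n b ↔
      ∀ k : Fin (n + 1), PowerSeries.coeff (k : ℕ) a = PowerSeries.coeff (k : ℕ) b := by
  rw [jetMk, Ideal.Quotient.mkₐ_eq_mk, Ideal.Quotient.eq, Ideal.mem_span_singleton,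
    PowerSeries.X_pow_dvd_iff]
  simp only [map_sub, sub_eq_zero]
  exact ⟨fun h k => h k k.2, fun h m hm => h ⟨m, hm⟩⟩

theorem jetMk_eq_zero_iff {a : ℂ⟦X⟧} :
    jetMk n a = 0 ↔ ∀ k : Fin (n + 1), PowerSeries.coeff (k : ℕ) a = 0 := by
  rw [← map_zero (jetMk n), jetMk_eq_iff]
  simp

theorem jetMk_surjective : Function.Surjective (jetMk n) :=
  Ideal.Quotient.mkₐ_surjective _ _

theorem isUnit_jetMk {f : ℂ⟦X⟧} (hf : PowerSeries.constantCoeff f ≠ 0) : IsUnit (jetMk n f) :=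
  (PowerSeries.isUnit_iff_constantCoeff.2 (isUnit_iff_ne_zero.2 hf)).map (jetMk n)

/-! ### Forms of degree d and their coefficient vectors. -/

/-- The exponent of the monomial `Z^α`. -/
def idxExp (α : MultiIdx n d) : Fin (n + 2) →₀ ℕ := Finsupp.equivFunOnFinite.symm α.1

theorem idxExp_injective : Function.Injective (idxExp (n := n) (d := d)) := fun _ _ h =>
  Subtype.ext (Finsupp.equivFunOnFinite.symm.injective h)

theorem degree_idxExp (α : MultiIdx n d) : (idxExp α).degree = d := by
  rw [Finsupp.degree_eq_sum]
  exact (Finset.mem_piAntidiag.1 α.2).1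

theorem exists_idxExp_eq {m : Fin (n + 2) →₀ ℕ} (hm : m.degree = d) :
    ∃ α : MultiIdx n d, idxExp α = m := by
  refine ⟨⟨m, ?_⟩, ?_⟩
  · rw [Finsupp.degree_eq_sum] at hm
    simp [Finset.mem_piAntidiag, hm]
  · ext i
    rfl

/-- The homogeneous polynomial `∑ A_α X^α` with given coefficients. -/
def hypPoly (n d : ℕ) : (MultiIdx n d → ℂ) →ₗ[ℂ] MvPolynomial (Fin (n + 2)) ℂ :=
  ∑ α : MultiIdx n d, (MvPolynomial.monomial (idxExp α)).comp (LinearMap.proj α)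

/-- The vector of the coefficients of degree `d` of a polynomial. -/
def coeffVec (n d : ℕ) : MvPolynomial (Fin (n + 2)) ℂ →ₗ[ℂ] (MultiIdx n d → ℂ) :=
  LinearMap.pi fun α => MvPolynomial.lcoeff ℂ (idxExp α)

theorem hypPoly_apply (a : MultiIdx n d → ℂ) :
    hypPoly n d a = ∑ α, MvPolynomial.monomial (idxExp α) (a α) := by
  simp [hypPoly]

theorem coeffVec_apply (P : MvPolynomial (Fin (n + 2)) ℂ) (α : MultiIdx n d) :
    coeffVec n d P α = P.coeff (idxExp α) := rfl

theorem hypPoly_isHomogeneous (a : MultiIdx n d → ℂ) : (hypPoly n d a).IsHomogeneous d := by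
  rw [hypPoly_apply]
  exact MvPolynomial.IsHomogeneous.sum _ _ _ fun α _ =>
    MvPolynomial.isHomogeneous_monomial _ (degree_idxExp α)

theorem coeffVec_hypPoly (a : MultiIdx n d → ℂ) : coeffVec n d (hypPoly n d a) = a := by
  classical
  funext α
  rw [coeffVec_apply, hypPoly_apply, MvPolynomial.coeff_sum]
  simp [MvPolynomial.coeff_monomial, idxExp_injective.eq_iff]

theorem hypPoly_coeffVec {P : MvPolynomial (Fin (n + 2)) ℂ} (hP : P.IsHomogeneous d) :
    hypPoly n d (coeffVec n d P) = P := by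
  ext m
  by_cases hm : m.degree = d
  · obtain ⟨α, rfl⟩ := exists_idxExp_eq hm
    exact congrFun (coeffVec_hypPoly (coeffVec n d P)) α
  · rw [(hypPoly_isHomogeneous _).coeff_eq_zero hm, hP.coeff_eq_zero hm]

/-- The hypersurface with coefficients `A`, as a polynomial. -/
def hypOf (x : Coord n d) : MvPolynomial (Fin (n + 2)) ℂ := hypPoly n d fun α => x (Sum.inr α)

theorem hypOf_isHomogeneous (x : Coord n d) : (hypOf x).IsHomogeneous d :=
  hypPoly_isHomogeneous _

theorem universalSeries_eq (x : Coord n d) :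
    universalSeries x = aeval (jetSeries x) (hypOf x) := by
  rw [universalSeries, hypOf, hypPoly_apply, map_sum]
  refine Finset.sum_congr rfl fun α _ => ?_
  rw [MvPolynomial.aeval_monomial, Finsupp.prod_fintype _ _ fun _ => pow_zero _]
  rfl

/-! ### Evaluation of forms on jets and changes of lift. -/

/-- The value of a polynomial on a jet. -/
def jetEval (x : Coord n d) : MvPolynomial (Fin (n + 2)) ℂ →ₐ[ℂ] JetRing n :=
  (jetMk n).comp (aeval (jetSeries x))

theorem jetEval_apply (x : Coord n d) (P : MvPolynomial (Fin (n + 2)) ℂ) :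
    jetEval x P = jetMk n (aeval (jetSeries x) P) := rfl

theorem jetEval_eq_aeval (x : Coord n d) (P : MvPolynomial (Fin (n + 2)) ℂ) :
    jetEval x P = aeval (fun i => jetMk n (jetSeries x i)) P := by
  rw [jetEval_apply, MvPolynomial.aeval_def, MvPolynomial.aeval_def, ← AlgHom.coe_toRingHom,
    MvPolynomial.hom_eval₂]
  rfl

theorem vertEqn_eq_zero_iff (x : Coord n d) :
    (∀ κ, vertEqn κ x = 0) ↔ jetEval x (hypOf x) = 0 := by
  rw [jetEval_apply, jetMk_eq_zero_iff, ← universalSeries_eq]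
  rfl

/-- The factor `c` is taken in the algebra and not in ℂ, so that nonconstant changes of lift are
covered. -/
theorem aeval_mul_of_isHomogeneous {σ R : Type*} [CommRing R] [Algebra ℂ R]
    {P : MvPolynomial σ ℂ} {e : ℕ} (hP : P.IsHomogeneous e) (c : R) (g : σ → R) :
    aeval (fun i => c * g i) P = c ^ e * aeval g P := by
  rw [MvPolynomial.aeval_def, MvPolynomial.aeval_def, MvPolynomial.eval₂_eq, MvPolynomial.eval₂_eq,
    Finset.mul_sum]
  refine Finset.sum_congr rfl fun m hm => ?_
  have : ∑ i ∈ m.support, m i = e := by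
    have := hP.coeff_eq_zero.mt (MvPolynomial.mem_support_iff.1 hm)
    exact not_not.1 this
  simp only [mul_pow, Finset.prod_mul_distrib, Finset.prod_pow_eq_pow_sum, this]
  ring

theorem jetMk_jetSeries_scale (f : ℂ⟦X⟧) (μ : ℂ) (x : Coord n d) (i : Fin (n + 2)) :
    jetMk n (jetSeries (scale f μ x) i) = jetMk n f * jetMk n (jetSeries x i) := by
  rw [← map_mul, jetMk_eq_iff]
  intro k
  rw [coeff_jetSeries]
  rfl

theorem jetEval_scale {P : MvPolynomial (Fin (n + 2)) ℂ} {e : ℕ} (hP : P.IsHomogeneous e)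
    (f : ℂ⟦X⟧) (μ : ℂ) (x : Coord n d) :
    jetEval (scale f μ x) P = jetMk n f ^ e * jetEval x P := by
  simp only [jetEval_eq_aeval, jetMk_jetSeries_scale]
  exact aeval_mul_of_isHomogeneous hP _ _

theorem hypOf_scale (f : ℂ⟦X⟧) (μ : ℂ) (x : Coord n d) :
    hypOf (scale f μ x) = μ • hypOf x := by
  rw [hypOf, hypOf, ← map_smul]
  rfl

theorem scale_inl_zero (f : ℂ⟦X⟧) (μ : ℂ) (x : Coord n d) (i : Fin (n + 2)) :
    scale f μ x (Sum.inl (i, 0)) = PowerSeries.constantCoeff f * x (Sum.inl (i, 0)) := by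
  have := coeff_jetSeries x i 0
  simp only [Fin.val_zero, PowerSeries.coeff_zero_eq_constantCoeff] at this
  simp [scale, this]

/-- The vertical jets are stable under a change of homogeneous coordinates. -/
def VertCone.scale (x : VertCone n d) {f : ℂ⟦X⟧} {μ : ℂ} (hf : PowerSeries.constantCoeff f ≠ 0)
    (hμ : μ ≠ 0) : VertCone n d :=
  ⟨_root_.scale f μ x.1, by
    obtain ⟨i, hi⟩ := x.2.1
    refine ⟨i, ?_⟩
    rw [scale_inl_zero]
    exact mul_ne_zero hf hi, by
    obtain ⟨α, hα⟩ := x.2.2.1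
    exact ⟨α, mul_ne_zero hμ hα⟩, by
    rw [vertEqn_eq_zero_iff, hypOf_scale, map_smul, jetEval_scale (hypOf_isHomogeneous x.1),
      (vertEqn_eq_zero_iff x.1).1 x.2.2.2, mul_zero, smul_zero]⟩

/-! ### Polynomial dependence on the coordinates. -/

/-- Polynomial functions of the homogeneous coordinates. -/
def IsPolyFun {σ : Type*} (F : (σ → ℂ) → ℂ) : Prop :=
  ∃ P : MvPolynomial σ ℂ, ∀ x, F x = MvPolynomial.eval x P

namespace IsPolyFun

variable {σ : Type*} {F G : (σ → ℂ) → ℂ}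

theorem const (c : ℂ) : IsPolyFun fun _ : σ → ℂ => c := ⟨MvPolynomial.C c, by simp⟩

theorem coord (j : σ) : IsPolyFun fun x : σ → ℂ => x j := ⟨MvPolynomial.X j, by simp⟩

theorem add (hF : IsPolyFun F) (hG : IsPolyFun G) : IsPolyFun fun x => F x + G x := by
  obtain ⟨P, hP⟩ := hF
  obtain ⟨Q, hQ⟩ := hG
  exact ⟨P + Q, by simp [hP, hQ]⟩

theorem mul (hF : IsPolyFun F) (hG : IsPolyFun G) : IsPolyFun fun x => F x * G x := by
  obtain ⟨P, hP⟩ := hF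
  obtain ⟨Q, hQ⟩ := hG
  exact ⟨P * Q, by simp [hP, hQ]⟩

theorem sub (hF : IsPolyFun F) (hG : IsPolyFun G) : IsPolyFun fun x => F x - G x := by
  obtain ⟨P, hP⟩ := hF
  obtain ⟨Q, hQ⟩ := hG
  exact ⟨P - Q, by simp [hP, hQ]⟩

theorem pow (hF : IsPolyFun F) (k : ℕ) : IsPolyFun fun x => F x ^ k := by
  obtain ⟨P, hP⟩ := hF
  exact ⟨P ^ k, by simp [hP]⟩

theorem sum {ι : Type*} {s : Finset ι} {F : ι → (σ → ℂ) → ℂ} (h : ∀ i ∈ s, IsPolyFun (F i)) :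
    IsPolyFun fun x => ∑ i ∈ s, F i x := by
  choose! P hP using h
  exact ⟨∑ i ∈ s, P i, fun x => by
    rw [map_sum]; exact Finset.sum_congr rfl fun i hi => hP i hi x⟩

theorem prod {ι : Type*} {s : Finset ι} {F : ι → (σ → ℂ) → ℂ} (h : ∀ i ∈ s, IsPolyFun (F i)) :
    IsPolyFun fun x => ∏ i ∈ s, F i x := by
  choose! P hP using h
  exact ⟨∏ i ∈ s, P i, fun x => by
    rw [map_prod]; exact Finset.prod_congr rfl fun i hi => hP i hi x⟩

theorem det {m : Type*} [Fintype m] [DecidableEq m] {M : (σ → ℂ) → Matrix m m ℂ}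
    (h : ∀ i j, IsPolyFun fun x => M x i j) : IsPolyFun fun x => (M x).det := by
  simp only [Matrix.det_apply']
  exact sum fun p _ => (const _).mul (prod fun i _ => h _ _)

theorem linearMap [Fintype σ] (φ : (σ → ℂ) →ₗ[ℂ] ℂ) : IsPolyFun fun x => φ x := by
  classical
  have : (fun x => φ x) = fun x => ∑ i, x i * φ fun j => if i = j then 1 else 0 :=
    funext fun x => LinearMap.pi_apply_eq_sum_univ φ x
  rw [this]
  exact sum fun i _ => (coord i).mul (const _)

theorem differentiable [Fintype σ] (hF : IsPolyFun F) : Differentiable ℂ F := by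
  obtain ⟨P, hP⟩ := hF
  obtain rfl : F = fun x => MvPolynomial.eval x P := funext hP
  intro x
  have := AnalyticAt.aeval_mvPolynomial (𝕜 := ℂ) (A := ℂ) (f := fun y : σ → ℂ => y) (z := x)
    (fun i => (ContinuousLinearMap.proj (R := ℂ) (φ := fun _ : σ => ℂ) i).analyticAt x) P
  exact this.differentiableAt

end IsPolyFun

theorem IsPolyFun.coeff_mul {σ : Type*} {F G : (σ → ℂ) → ℂ⟦X⟧}
    (hF : ∀ k, IsPolyFun fun x => PowerSeries.coeff k (F x))
    (hG : ∀ k, IsPolyFun fun x => PowerSeries.coeff k (G x)) (k : ℕ) :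
    IsPolyFun fun x => PowerSeries.coeff k (F x * G x) := by
  simp only [PowerSeries.coeff_mul]
  exact IsPolyFun.sum fun p _ => (hF _).mul (hG _)

theorem isPoly_coeff_jetSeries (i : Fin (n + 2)) (k : ℕ) :
    IsPolyFun fun x : Coord n d => PowerSeries.coeff k (jetSeries x i) := by
  simp only [jetSeries, PowerSeries.coeff_mk]
  split_ifs with h
  · exact IsPolyFun.coord _
  · exact IsPolyFun.const 0

theorem isPoly_coeff_aeval (P : MvPolynomial (Fin (n + 2)) ℂ) :
    ∀ k, IsPolyFun fun x : Coord n d => PowerSeries.coeff k (aeval (jetSeries x) P) := by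
  induction P using MvPolynomial.induction_on with
  | C a => intro k; simpa using IsPolyFun.const _
  | add p q hp hq => intro k; simpa using (hp k).add (hq k)
  | mul_X p i hp =>
    intro k
    simpa using IsPolyFun.coeff_mul hp (isPoly_coeff_jetSeries i) k

theorem vertEqn_eq_sum (κ : Fin (n + 1)) (x : Coord n d) :
    vertEqn κ x = ∑ α : MultiIdx n d, x (Sum.inr α) *
      PowerSeries.coeff (κ : ℕ) (aeval (jetSeries x) (MvPolynomial.monomial (idxExp α) (1 : ℂ))) := by
  rw [vertEqn, universalSeries_eq, hypOf, hypPoly_apply, map_sum, map_sum]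
  refine Finset.sum_congr rfl fun α _ => ?_
  rw [← PowerSeries.coeff_C_mul, ← mul_one (x (Sum.inr α)), ← MvPolynomial.C_mul_monomial, map_mul,
    MvPolynomial.aeval_C, mul_one]
  rfl

theorem isPoly_vertEqn (κ : Fin (n + 1)) : IsPolyFun (vertEqn (n := n) (d := d) κ) := by
  have h : IsPolyFun fun x : Coord n d => ∑ α : MultiIdx n d, x (Sum.inr α) *
      PowerSeries.coeff (κ : ℕ) (aeval (jetSeries x) (MvPolynomial.monomial (idxExp α) (1 : ℂ))) := by
    refine IsPolyFun.sum fun α _ => ?_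
    have h1 : IsPolyFun fun x : Coord n d => x (Sum.inr α) := IsPolyFun.coord _
    exact h1.mul (isPoly_coeff_aeval _ (κ : ℕ))
  obtain ⟨P, hP⟩ := h
  exact ⟨P, fun x => (vertEqn_eq_sum κ x).trans (hP x)⟩

/-! ### The differentials of the defining equations. -/

/-- Coefficientwise differentiability at `0` of a family of power series. -/
def HasCoeffDeriv (F : ℂ → ℂ⟦X⟧) (F' : ℂ⟦X⟧) : Prop :=
  ∀ k, HasDerivAt (fun t => PowerSeries.coeff k (F t)) (PowerSeries.coeff k F') 0

theorem HasCoeffDeriv.add {F G : ℂ → ℂ⟦X⟧} {F' G' : ℂ⟦X⟧} (hF : HasCoeffDeriv F F')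
    (hG : HasCoeffDeriv G G') : HasCoeffDeriv (fun t => F t + G t) (F' + G') := fun k => by
  simp only [map_add]
  exact (hF k).fun_add (hG k)

theorem HasCoeffDeriv.mul {F G : ℂ → ℂ⟦X⟧} {F' G' : ℂ⟦X⟧} (hF : HasCoeffDeriv F F')
    (hG : HasCoeffDeriv G G') : HasCoeffDeriv (fun t => F t * G t) (F' * G 0 + F 0 * G') :=
  fun k => by
  simp only [map_add, PowerSeries.coeff_mul, ← Finset.sum_add_distrib]
  exact HasDerivAt.fun_sum fun p _ => (hF p.1).mul (hG p.2)

theorem HasCoeffDeriv.aeval {σ : Type*} [Fintype σ] {F : ℂ → σ → ℂ⟦X⟧} {F' : σ → ℂ⟦X⟧}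
    (hF : ∀ i, HasCoeffDeriv (fun t => F t i) (F' i)) (P : MvPolynomial σ ℂ) :
    HasCoeffDeriv (fun t => MvPolynomial.aeval (F t) P)
      (∑ i, MvPolynomial.aeval (F 0) (pderiv i P) * F' i) := by
  classical
  induction P using MvPolynomial.induction_on with
  | C a => intro k; simpa using hasDerivAt_const (0 : ℂ) _
  | add p q hp hq => simpa [add_mul, Finset.sum_add_distrib] using hp.add hq
  | mul_X p i hp =>
    have := hp.mul (hF i)
    simp only [map_mul, MvPolynomial.aeval_X, Derivation.leibniz, MvPolynomial.pderiv_X, map_add,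
      smul_eq_mul, add_mul, Finset.sum_add_distrib]
    convert this using 1
    rw [add_comm, Finset.sum_mul]
    congr 1
    · exact Finset.sum_congr rfl fun j _ => by ring
    · rw [Finset.sum_eq_single i] <;> simp +contextual [eq_comm]

theorem jetSeries_add_smul (x w : Coord n d) (t : ℂ) (i : Fin (n + 2)) :
    jetSeries (x + t • w) i = jetSeries x i + t • jetSeries w i := by
  ext k
  by_cases h : k < n + 1 <;> simp only [jetSeries, map_add, PowerSeries.coeff_smul,
    PowerSeries.coeff_mk, h, dif_pos, dif_neg, not_false_eq_true] <;> simp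

theorem hypOf_add_smul (x w : Coord n d) (t : ℂ) : hypOf (x + t • w) = hypOf x + t • hypOf w := by
  rw [hypOf, hypOf, hypOf, ← map_smul, ← map_add]
  rfl

theorem hasCoeffDeriv_line (a b : ℂ⟦X⟧) : HasCoeffDeriv (fun t => a + t • b) b := fun k => by
  simpa using ((hasDerivAt_id (0 : ℂ)).mul_const (PowerSeries.coeff k b)).const_add
    (PowerSeries.coeff k a)

/-- The differential of the total derivatives of the universal equation. -/
theorem fderiv_vertEqn (κ : Fin (n + 1)) (x w : Coord n d) :
    fderiv ℂ (vertEqn (n := n) (d := d) κ) x w = PowerSeries.coeff (κ : ℕ)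
      (aeval (jetSeries x) (hypOf w) +
        ∑ i, aeval (jetSeries x) (pderiv i (hypOf x)) * jetSeries w i) := by
  have h1 : HasDerivAt (fun t : ℂ => vertEqn κ (x + t • w))
      (fderiv ℂ (vertEqn (n := n) (d := d) κ) x w) 0 := by
    have hd := ((isPoly_vertEqn (d := d) κ).differentiable x).hasFDerivAt
    have hl : HasDerivAt (fun t : ℂ => x + t • w) w 0 := by
      simpa using ((hasDerivAt_id (0 : ℂ)).smul_const w).const_add x
    have : x = x + (0 : ℂ) • w := by simp
    rw [this] at hd
    have := hd.comp_hasDerivAt (0 : ℂ) hl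
    rwa [zero_smul, add_zero] at this
  refine h1.unique ?_
  have hZ : ∀ i, HasCoeffDeriv (fun t => jetSeries (x + t • w) i) (jetSeries w i) := fun i => by
    simp only [jetSeries_add_smul]
    exact hasCoeffDeriv_line _ _
  have hc : HasCoeffDeriv (fun t => PowerSeries.C t) 1 := by
    have := hasCoeffDeriv_line 0 1
    simpa [PowerSeries.smul_eq_C_mul] using this
  -- Along the line the equation is F + tG. The product rule for the factor t leaves only G(Z) at t
  -- = 0.
  have := (HasCoeffDeriv.aeval hZ (hypOf x)).add (hc.mul (HasCoeffDeriv.aeval hZ (hypOf w)))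
  have h2 := this κ
  simp only [zero_smul, add_zero, map_zero, zero_mul, one_mul] at h2
  refine HasDerivAt.congr_deriv (h2.congr_of_eventuallyEq (Filter.Eventually.of_forall ?_))
    (congrArg _ (add_comm _ _))
  intro t
  simp only [vertEqn]
  rw [universalSeries_eq, hypOf_add_smul, map_add, map_smul, PowerSeries.smul_eq_C_mul]

/-! ### Linear forms and nondegenerate jets. -/

/-- The linear form with given coefficients. -/
def linForm (a : Fin (n + 2) → ℂ) : MvPolynomial (Fin (n + 2)) ℂ :=
  ∑ i, MvPolynomial.C (a i) * MvPolynomial.X i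

theorem linForm_isHomogeneous (a : Fin (n + 2) → ℂ) : (linForm a).IsHomogeneous 1 :=
  MvPolynomial.IsHomogeneous.sum _ _ _ fun _ _ => MvPolynomial.isHomogeneous_C_mul_X _ _

theorem aeval_linForm {R : Type*} [CommRing R] [Algebra ℂ R] (z : Fin (n + 2) → R)
    (a : Fin (n + 2) → ℂ) : aeval z (linForm a) = ∑ i, a i • z i := by
  simp [linForm, Algebra.smul_def]

theorem jetEval_linForm (x : Coord n d) (a : Fin (n + 2) → ℂ) :
    jetEval x (linForm a) = ∑ i, a i • jetMk n (jetSeries x i) := by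
  rw [jetEval_eq_aeval, aeval_linForm]

/-- A jet is nondegenerate when the `n`-jets of the components of a lift span the `n`-jets of
functions, i.e. when `Z, Z', …, Z^{(n)}` are linearly independent. -/
def IsNondeg (x : Coord n d) : Prop :=
  ∀ r : JetRing n, ∃ a : Fin (n + 2) → ℂ, jetEval x (linForm a) = r

/-- Powers of a linear form with jet 1 raise the degree without changing the jet. -/
theorem IsNondeg.exists_form {x : Coord n d} (hx : IsNondeg x) (e : ℕ) (he : 1 ≤ e)
    (r : JetRing n) :
    ∃ P : MvPolynomial (Fin (n + 2)) ℂ, P.IsHomogeneous e ∧ jetEval x P = r := by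
  obtain ⟨a, ha⟩ := hx 1
  obtain ⟨b, hb⟩ := hx r
  refine ⟨linForm a ^ (e - 1) * linForm b, ?_, by rw [map_mul, map_pow, ha, hb, one_pow, one_mul]⟩
  have := ((linForm_isHomogeneous a).pow (e - 1)).mul (linForm_isHomogeneous b)
  rwa [one_mul, Nat.sub_add_cancel he] at this

/-! ### Vertical tangent vectors and smoothness. -/

/-- The tangent vector that moves the hypersurface in the direction `P` and fixes the jet. -/
def verticalVec (n d : ℕ) : MvPolynomial (Fin (n + 2)) ℂ →ₗ[ℂ] Coord n d where
  toFun P := Sum.elim (fun _ => 0) (coeffVec n d P)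
  map_add' P Q := by funext j; rcases j with j | α <;> simp
  map_smul' c P := by funext j; rcases j with j | α <;> simp

theorem verticalVec_inl (P : MvPolynomial (Fin (n + 2)) ℂ) (p : Fin (n + 2) × Fin (n + 1)) :
    verticalVec n d P (Sum.inl p) = 0 := rfl

theorem hypOf_verticalVec {P : MvPolynomial (Fin (n + 2)) ℂ} (hP : P.IsHomogeneous d) :
    hypOf (verticalVec n d P) = P :=
  hypPoly_coeffVec hP

theorem jetSeries_eq_zero {x : Coord n d} {i : Fin (n + 2)} (h : ∀ k, x (Sum.inl (i, k)) = 0) :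
    jetSeries x i = 0 := by
  ext k
  simp [jetSeries, h]

theorem jetSeries_verticalVec (P : MvPolynomial (Fin (n + 2)) ℂ) (i : Fin (n + 2)) :
    jetSeries (verticalVec n d P) i = 0 :=
  jetSeries_eq_zero fun _ => rfl

/-- The common kernel of the differentials of the defining functions. -/
def tangentCone (x : Coord n d) : Submodule ℂ (Coord n d) :=
  ⨅ κ : Fin (n + 1), LinearMap.ker (fderiv ℂ (vertEqn (n := n) (d := d) κ) x).toLinearMap

theorem mem_tangentCone_iff {x w : Coord n d} :
    w ∈ tangentCone x ↔ jetEval x (hypOf w) +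
      ∑ i, jetEval x (pderiv i (hypOf x)) * jetMk n (jetSeries w i) = 0 := by
  have : jetEval x (hypOf w) + ∑ i, jetEval x (pderiv i (hypOf x)) * jetMk n (jetSeries w i) =
      jetMk n (aeval (jetSeries x) (hypOf w) +
        ∑ i, aeval (jetSeries x) (pderiv i (hypOf x)) * jetSeries w i) := by
    simp only [jetEval_apply, map_add, map_sum, map_mul]
  rw [this, jetMk_eq_zero_iff, tangentCone, Submodule.mem_iInf]
  simp only [← fderiv_vertEqn]
  rfl

theorem verticalVec_mem_tangentCone_iff {x : Coord n d} {P : MvPolynomial (Fin (n + 2)) ℂ}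
    (hP : P.IsHomogeneous d) : verticalVec n d P ∈ tangentCone x ↔ jetEval x P = 0 := by
  rw [mem_tangentCone_iff, hypOf_verticalVec hP]
  simp [jetSeries_verticalVec]

/-- Forms with jets 1, ζ, …, ζ^n give vertical vectors dual to the differentials. -/
theorem smoothAt_of_isNondeg (hd : 1 ≤ d) {x : VertCone n d} (hx : IsNondeg x.1) : SmoothAt x := by
  rw [SmoothAt, Fintype.linearIndependent_iff]
  intro g hg κ
  obtain ⟨P, hP, hPx⟩ := hx.exists_form d hd (jetMk n (PowerSeries.X ^ (κ : ℕ)))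
  have key : ∀ κ' : Fin (n + 1), fderiv ℂ (vertEqn (n := n) (d := d) κ') x.1 (verticalVec n d P) =
      if κ' = κ then 1 else 0 := fun κ' => by
    rw [fderiv_vertEqn, hypOf_verticalVec hP]
    simp only [jetSeries_verticalVec, mul_zero, Finset.sum_const_zero, add_zero]
    rw [jetEval_apply, jetMk_eq_iff] at hPx
    rw [hPx κ', PowerSeries.coeff_X_pow]
    simp only [Fin.ext_iff]
  have := congrArg (fun L => L (verticalVec n d P)) hg
  simpa [key] using this

theorem scale_sub_right (f : ℂ⟦X⟧) (μ : ℂ) (v w : Coord n d) :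
    scale f μ (v - w) = scale f μ v - scale f μ w := by
  have hj : ∀ i, jetSeries (v - w) i = jetSeries v i - jetSeries w i := fun i => by
    have := jetSeries_add_smul v w (-1) i
    simpa [sub_eq_add_neg] using this
  funext j
  rcases j with ⟨i, k⟩ | α
  · simp [scale, hj, mul_sub]
  · simp [scale, mul_sub]

theorem scale_smul_right (f : ℂ⟦X⟧) (μ c : ℂ) (v : Coord n d) :
    scale f μ (c • v) = c • scale f μ v := by
  have hj : ∀ i, jetSeries (c • v) i = c • jetSeries v i := fun i => by
    have := jetSeries_add_smul 0 v c i
    rwa [zero_add, jetSeries_eq_zero (x := 0) fun _ => rfl, zero_add] at this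
  funext j
  rcases j with ⟨i, k⟩ | α
  · simp [scale, hj]
  · simp only [scale, Pi.smul_apply, smul_eq_mul]
    ring

theorem scale_verticalVec (f : ℂ⟦X⟧) (μ : ℂ) (P : MvPolynomial (Fin (n + 2)) ℂ) :
    scale f μ (verticalVec n d P) = μ • verticalVec n d P := by
  funext j
  rcases j with ⟨i, k⟩ | α
  · simp [scale, jetSeries_verticalVec, verticalVec_inl]
  · simp [scale]

/-! ### Global sections from equivariant polynomial fields. -/

/-- The vectors whose class is a combination of values of global sections. -/
def sectionSpan (c c' : ℕ) (x : VertCone n d) : Submodule ℂ (Coord n d) :=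
  (Submodule.span ℂ {w | ∃ s, IsGlobalSection c c' s ∧ s x = w}).comap (orbitTangent x.1).mkQ

theorem globallyGeneratedAt_of_le {c c' : ℕ} {x : VertCone n d}
    (h : tangentCone x.1 ≤ sectionSpan c c' x) : GloballyGeneratedAt c c' x := by
  refine le_antisymm (Submodule.span_le.2 ?_) (Submodule.map_le_iff_le_comap.2 h)
  rintro _ ⟨s, hs, rfl⟩
  exact hs.tangent x

/-- Equivariant polynomial tangent vector fields on the space of homogeneous coordinates induce
global sections. -/
theorem mem_sectionSpan_of_field {c c' : ℕ} (V : Coord n d → Coord n d)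
    (hpoly : ∀ j, IsPolyFun fun x => V x j) (htan : ∀ x : VertCone n d, V x.1 ∈ tangentCone x.1)
    (hequi : ∀ (x : Coord n d) (f : ℂ⟦X⟧) (μ : ℂ),
      V (scale f μ x) = (PowerSeries.constantCoeff f ^ c * μ ^ c') • scale f μ (V x))
    (x : VertCone n d) : V x.1 ∈ sectionSpan c c' x := by
  refine Submodule.subset_span ⟨fun y => (orbitTangent y.1).mkQ (V y.1), ⟨fun y => ?_, ?_, ?_⟩, rfl⟩
  · exact Submodule.mem_map_of_mem (htan y)
  · intro x y f μ _ _ hy w hw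
    have hw' : V x.1 - w ∈ orbitTangent x.1 := (Submodule.Quotient.eq _).1 hw
    refine (Submodule.Quotient.eq _).2 ?_
    obtain ⟨g, ν, hg⟩ := hw'
    have : V y.1 = (PowerSeries.constantCoeff f ^ c * μ ^ c') • scale f μ (V x.1) := by
      rw [hy, hequi]
    -- The group of pairs (f, μ) is commutative, so its action carries orbit directions at x to
    -- orbit directions at y. The choice of representative `w` is therefore harmless.
    rw [this, ← smul_sub, ← scale_sub_right, hg, scale_scale, mul_comm f g, mul_comm μ ν,
      ← scale_scale, ← hy]
    exact Submodule.smul_mem _ _ ⟨g, ν, rfl⟩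
  · choose P hP using hpoly
    intro x
    refine ⟨1, P, by simp, fun y _ => ?_⟩
    simp only [map_one, one_smul, ← hP]

/-! ### Linear fields from gl_{n+2}. -/

/-- The linear vector field given by the action of a matrix on `ℂ^{n+2}`. -/
def glField (d : ℕ) (g : Matrix (Fin (n + 2)) (Fin (n + 2)) ℂ) : Coord n d →ₗ[ℂ] Coord n d where
  toFun x := Sum.elim (fun p => ∑ j, g p.1 j * x (Sum.inl (j, p.2)))
    (coeffVec n d (-∑ i, pderiv i (hypOf x) * linForm (g i)))
  map_add' x y := by
    have : hypOf (x + y) = hypOf x + hypOf y := by simpa using hypOf_add_smul x y 1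
    funext j
    rcases j with p | α
    · simp [mul_add, Finset.sum_add_distrib]
    · simp only [this, map_add, add_mul, Finset.sum_add_distrib, neg_add, Sum.elim_inr,
        Pi.add_apply]
  map_smul' c x := by
    have : hypOf (c • x) = c • hypOf x := by
      rw [hypOf, hypOf, ← map_smul]
      rfl
    funext j
    rcases j with p | α
    · simp only [Sum.elim_inl, Pi.smul_apply, smul_eq_mul, RingHom.id_apply, Finset.mul_sum]
      exact Finset.sum_congr rfl fun j _ => by ring
    · simp only [this, map_smul, Derivation.map_smul, smul_mul_assoc, ← Finset.smul_sum,
        ← smul_neg, Sum.elim_inr, Pi.smul_apply, RingHom.id_apply]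

theorem glField_inl (g : Matrix (Fin (n + 2)) (Fin (n + 2)) ℂ) (x : Coord n d) (i : Fin (n + 2))
    (k : Fin (n + 1)) : glField d g x (Sum.inl (i, k)) = ∑ j, g i j * x (Sum.inl (j, k)) := rfl

theorem glField_inr (g : Matrix (Fin (n + 2)) (Fin (n + 2)) ℂ) (x : Coord n d) (α : MultiIdx n d) :
    glField d g x (Sum.inr α) =
      coeffVec n d (-∑ i, pderiv i (hypOf x) * linForm (g i)) α := rfl

theorem jetSeries_glField (g : Matrix (Fin (n + 2)) (Fin (n + 2)) ℂ) (x : Coord n d)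
    (i : Fin (n + 2)) : jetSeries (glField d g x) i = ∑ j, g i j • jetSeries x j := by
  ext k
  rw [map_sum]
  by_cases h : k < n + 1
  · simp only [jetSeries, PowerSeries.coeff_mk, dif_pos h, map_smul, smul_eq_mul]
    rfl
  · simp only [jetSeries, PowerSeries.coeff_mk, dif_neg h, map_smul, smul_zero,
      Finset.sum_const_zero]

theorem hypOf_glField (hd : 1 ≤ d) (g : Matrix (Fin (n + 2)) (Fin (n + 2)) ℂ) (x : Coord n d) :
    hypOf (glField d g x) = -∑ i, pderiv i (hypOf x) * linForm (g i) := by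
  refine (congrArg (hypPoly n d) (funext (glField_inr g x))).trans (hypPoly_coeffVec ?_)
  refine (MvPolynomial.IsHomogeneous.sum _ _ _ fun i _ => ?_).neg
  have := (hypOf_isHomogeneous x).pderiv (i := i) |>.mul (linForm_isHomogeneous (g i))
  rwa [Nat.sub_add_cancel hd] at this

/-- This is the infinitesimal invariance of incidence: the sign in the equation component cancels
the chain rule term. -/
theorem glField_mem_tangentCone (hd : 1 ≤ d) (g : Matrix (Fin (n + 2)) (Fin (n + 2)) ℂ)
    (x : Coord n d) : glField d g x ∈ tangentCone x := by
  rw [mem_tangentCone_iff, hypOf_glField hd, map_neg, map_sum, neg_add_eq_zero]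
  refine Finset.sum_congr rfl fun i _ => ?_
  rw [map_mul, jetEval_linForm, jetSeries_glField, map_sum]
  simp only [map_smul]

theorem glField_scale (g : Matrix (Fin (n + 2)) (Fin (n + 2)) ℂ) (f : ℂ⟦X⟧) (μ : ℂ)
    (x : Coord n d) : glField d g (scale f μ x) = scale f μ (glField d g x) := by
  funext j
  rcases j with ⟨i, k⟩ | α
  · simp only [glField_inl, scale, jetSeries_glField, Finset.mul_sum, map_sum,
      mul_smul_comm, map_smul, smul_eq_mul]
  · have : -∑ i, pderiv i (hypOf (scale f μ x)) * linForm (g i) =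
        μ • -∑ i, pderiv i (hypOf x) * linForm (g i) := by
      simp only [hypOf_scale, Derivation.map_smul, smul_mul_assoc, ← Finset.smul_sum, smul_neg]
    rw [glField_inr, this, map_smul]
    rfl

/-- The linear field has weight zero. A monomial in one Z_i(0) and one A_α, both nonzero at `x`,
supplies the twist, and its value at `x` is divided out. -/
theorem glField_mem_sectionSpan (hd : 1 ≤ d) (c : ℕ)
    (g : Matrix (Fin (n + 2)) (Fin (n + 2)) ℂ) (x : VertCone n d) :
    glField d g x.1 ∈ sectionSpan c 1 x := by
  obtain ⟨i, hi⟩ := x.2.1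
  obtain ⟨α, hα⟩ := x.2.2.1
  have := mem_sectionSpan_of_field (c := c) (c' := 1)
    (fun y : Coord n d => (y (Sum.inl (i, 0)) ^ c * y (Sum.inr α)) • glField d g y)
    (fun j => (((IsPolyFun.coord (Sum.inl (i, 0))).pow c).mul (IsPolyFun.coord (Sum.inr α))).mul
      (IsPolyFun.linearMap ((LinearMap.proj j).comp (glField d g))))
    (fun y => Submodule.smul_mem _ _ (glField_mem_tangentCone hd g y.1))
    (fun y f μ => by
      simp only [glField_scale, scale_smul_right, smul_smul, scale_inl_zero]
      congr 1
      simp only [scale]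
      ring) x
  exact (Submodule.smul_mem_iff _ (mul_ne_zero (pow_ne_zero c hi) hα)).1 this

/-- Equivariant families of hypersurfaces containing the jet induce global sections. -/
theorem verticalVec_mem_sectionSpan {b c : ℕ} (hbc : b ≤ c)
    (B : Coord n d → MvPolynomial (Fin (n + 2)) ℂ)
    (hpoly : ∀ m, IsPolyFun fun x => (B x).coeff m) (hhom : ∀ x, (B x).IsHomogeneous d)
    (hzero : ∀ x, jetEval x (B x) = 0)
    (hequi : ∀ (x : Coord n d) (f : ℂ⟦X⟧) (μ : ℂ),
      B (scale f μ x) = PowerSeries.constantCoeff f ^ b • B x)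
    (x : VertCone n d) : verticalVec n d (B x.1) ∈ sectionSpan c 1 x := by
  obtain ⟨i, hi⟩ := x.2.1
  obtain ⟨α, hα⟩ := x.2.2.1
  have := mem_sectionSpan_of_field (c := c) (c' := 1)
    -- The factor A_α is squared because a vertical vector itself transforms by μ: one power of μ
    -- pays for the transport, the other for 𝒪(1).
    (fun y : Coord n d =>
      (y (Sum.inl (i, 0)) ^ (c - b) * y (Sum.inr α) ^ 2) • verticalVec n d (B y))
    (fun j => (((IsPolyFun.coord (Sum.inl (i, 0))).pow (c - b)).mul
      ((IsPolyFun.coord (Sum.inr α)).pow 2)).mul (by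
        rcases j with p | β
        · exact IsPolyFun.const 0
        · exact hpoly _))
    (fun y => Submodule.smul_mem _ _
      ((verticalVec_mem_tangentCone_iff (hhom y.1)).2 (hzero y.1)))
    (fun y f μ => by
      obtain ⟨e, rfl⟩ := Nat.exists_eq_add_of_le hbc
      simp only [hequi, map_smul, scale_smul_right, smul_smul, scale_inl_zero, scale_verticalVec]
      congr 1
      simp only [scale, Nat.add_sub_cancel_left]
      ring) x
  exact (Submodule.smul_mem_iff _ (mul_ne_zero (pow_ne_zero _ hi) (pow_ne_zero 2 hα))).1 this

/-! ### Cramer's rule for forms vanishing on a jet. -/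

/-- The matrix of multiplication by a power series on `n`-jets of functions. -/
def mulMatrix (n : ℕ) (g : ℂ⟦X⟧) : Matrix (Fin (n + 1)) (Fin (n + 1)) ℂ :=
  Matrix.of fun k l => if l ≤ k then PowerSeries.coeff (k - l : ℕ) g else 0

theorem coeff_mul_eq_mulMatrix (g h : ℂ⟦X⟧) (k : Fin (n + 1)) :
    PowerSeries.coeff (k : ℕ) (g * h) =
      ∑ l : Fin (n + 1), mulMatrix n g k l * PowerSeries.coeff (l : ℕ) h := by
  rw [mul_comm, PowerSeries.coeff_mul, Finset.Nat.sum_antidiagonal_eq_sum_range_succ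
    fun i j => PowerSeries.coeff i h * PowerSeries.coeff j g]
  have : ∀ l : Fin (n + 1), mulMatrix n g k l * PowerSeries.coeff (l : ℕ) h =
      (fun l : ℕ => if l ≤ k then PowerSeries.coeff l h * PowerSeries.coeff (k - l : ℕ) g else 0)
        l := fun l => by
    rw [mulMatrix, Matrix.of_apply, ite_mul, zero_mul, mul_comm (PowerSeries.coeff _ g)]
    rfl
  rw [Finset.sum_congr rfl fun l _ => this l, Fin.sum_univ_eq_sum_range
    fun l => if l ≤ k then PowerSeries.coeff l h * PowerSeries.coeff (k - l : ℕ) g else 0]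
  rw [← Finset.sum_subset (Finset.range_subset_range.2 k.2)]
  · refine Finset.sum_congr rfl fun l hl => ?_
    rw [if_pos (Nat.lt_succ_iff.1 (Finset.mem_range.1 hl))]
  · intro l _ hl
    rw [if_neg fun h => hl (Finset.mem_range.2 (Nat.lt_succ_iff.2 h))]

/-- The matrix is lower triangular with constant diagonal g(0). This is why only f(0) enters the
weight of the Cramer families. -/
theorem det_mulMatrix (g : ℂ⟦X⟧) :
    (mulMatrix n g).det = PowerSeries.constantCoeff g ^ (n + 1) := by
  rw [Matrix.det_of_isLowerTriangular]
  · simp [mulMatrix]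
  · intro k l hkl
    simp only [mulMatrix, Matrix.of_apply]
    exact if_neg (not_le.2 hkl)

/-- The matrix of the Taylor coefficients along a jet of a family of polynomials. -/
def jetMatrix (p : Fin (n + 1) → MvPolynomial (Fin (n + 2)) ℂ) (x : Coord n d) :
    Matrix (Fin (n + 1)) (Fin (n + 1)) ℂ :=
  Matrix.of fun k j => PowerSeries.coeff (k : ℕ) (aeval (jetSeries x) (p j))

/-- The vector of the Taylor coefficients along a jet of a polynomial. -/
def jetVector (q : MvPolynomial (Fin (n + 2)) ℂ) (x : Coord n d) : Fin (n + 1) → ℂ :=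
  fun k => PowerSeries.coeff (k : ℕ) (aeval (jetSeries x) q)

theorem jetVector_scale {q : MvPolynomial (Fin (n + 2)) ℂ} {e : ℕ} (hq : q.IsHomogeneous e)
    (f : ℂ⟦X⟧) (μ : ℂ) (x : Coord n d) :
    jetVector q (scale f μ x) = (mulMatrix n (f ^ e)).mulVec (jetVector q x) := by
  funext k
  have := jetEval_scale hq f μ x
  rw [jetEval_apply, jetEval_apply, ← map_pow, ← map_mul, jetMk_eq_iff] at this
  rw [jetVector, this k, coeff_mul_eq_mulMatrix]
  rfl

theorem jetMatrix_scale {p : Fin (n + 1) → MvPolynomial (Fin (n + 2)) ℂ} {e : ℕ}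
    (hp : ∀ j, (p j).IsHomogeneous e) (f : ℂ⟦X⟧) (μ : ℂ) (x : Coord n d) :
    jetMatrix p (scale f μ x) = mulMatrix n (f ^ e) * jetMatrix p x := by
  ext k j
  exact congrFun (jetVector_scale (hp j) f μ x) k

/-- Multiplying a linear system by T keeps its solution, so the Cramer numerators change only by det
T. -/
theorem cramer_mul_mulVec {m : Type*} [Fintype m] [DecidableEq m] (T A : Matrix m m ℂ) (b : m → ℂ) :
    (T * A).cramer (T.mulVec b) = T.det • A.cramer b := by
  rw [Matrix.cramer_eq_adjugate_mulVec, Matrix.cramer_eq_adjugate_mulVec,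
    Matrix.adjugate_mul_distrib, Matrix.mulVec_mulVec, Matrix.mul_assoc, Matrix.adjugate_mul,
    Matrix.mul_smul, Matrix.mul_one, Matrix.smul_mulVec]

/-- The combination of `q` and the `p_j`, with coefficients given by Cramer's rule, that vanishes
along the jet. -/
def cramerForm (p : Fin (n + 1) → MvPolynomial (Fin (n + 2)) ℂ) (q : MvPolynomial (Fin (n + 2)) ℂ)
    (x : Coord n d) : MvPolynomial (Fin (n + 2)) ℂ :=
  (jetMatrix p x).det • q - ∑ j, (jetMatrix p x).cramer (jetVector q x) j • p j

theorem jetEval_cramerForm (p : Fin (n + 1) → MvPolynomial (Fin (n + 2)) ℂ)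
    (q : MvPolynomial (Fin (n + 2)) ℂ) (x : Coord n d) : jetEval x (cramerForm p q x) = 0 := by
  rw [jetEval_apply, jetMk_eq_zero_iff]
  intro k
  have := congrFun (Matrix.mulVec_cramer (jetMatrix p x) (jetVector q x)) k
  simp only [Matrix.mulVec, dotProduct, Pi.smul_apply, smul_eq_mul] at this
  simp only [cramerForm, map_sub, map_sum, map_smul, smul_eq_mul]
  rw [sub_eq_zero]
  refine this.symm.trans (Finset.sum_congr rfl fun j _ => mul_comm _ _)

theorem cramerForm_scale {p : Fin (n + 1) → MvPolynomial (Fin (n + 2)) ℂ}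
    {q : MvPolynomial (Fin (n + 2)) ℂ} {e : ℕ} (hp : ∀ j, (p j).IsHomogeneous e)
    (hq : q.IsHomogeneous e) (f : ℂ⟦X⟧) (μ : ℂ) (x : Coord n d) :
    cramerForm p q (scale f μ x) =
      PowerSeries.constantCoeff f ^ (e * (n + 1)) • cramerForm p q x := by
  rw [cramerForm, jetMatrix_scale hp, jetVector_scale hq, cramer_mul_mulVec, Matrix.det_mul,
    det_mulMatrix, map_pow, ← pow_mul, cramerForm, smul_sub, Finset.smul_sum]
  simp only [Pi.smul_apply, smul_eq_mul, smul_smul]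

theorem isPoly_jetVector (q : MvPolynomial (Fin (n + 2)) ℂ) (k : Fin (n + 1)) :
    IsPolyFun fun x : Coord n d => jetVector q x k :=
  isPoly_coeff_aeval q (k : ℕ)

theorem isPoly_coeff_mul_left (M : MvPolynomial (Fin (n + 2)) ℂ)
    {B : Coord n d → MvPolynomial (Fin (n + 2)) ℂ} (h : ∀ m, IsPolyFun fun x => (B x).coeff m)
    (m : Fin (n + 2) →₀ ℕ) : IsPolyFun fun x => (M * B x).coeff m := by
  simp only [MvPolynomial.coeff_mul]
  exact IsPolyFun.sum fun p _ => (IsPolyFun.const _).mul (h _)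

theorem isPoly_coeff_cramerForm (p : Fin (n + 1) → MvPolynomial (Fin (n + 2)) ℂ)
    (q : MvPolynomial (Fin (n + 2)) ℂ) (m : Fin (n + 2) →₀ ℕ) :
    IsPolyFun fun x : Coord n d => (cramerForm p q x).coeff m := by
  simp only [cramerForm, MvPolynomial.coeff_sub, MvPolynomial.coeff_sum, MvPolynomial.coeff_smul,
    smul_eq_mul, Matrix.cramer_apply]
  refine (IsPolyFun.mul (IsPolyFun.det fun k j => isPoly_jetVector (p j) k)
    (IsPolyFun.const _)).sub (IsPolyFun.sum fun j _ => IsPolyFun.mul (IsPolyFun.det fun k l => ?_)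
      (IsPolyFun.const _))
  by_cases h : l = j
  · subst h
    simpa only [Matrix.updateCol_self] using isPoly_jetVector q k
  · simp only [Matrix.updateCol_ne h]
    exact isPoly_jetVector (p l) k

/-- Multiples of a form of degree `e` vanishing on the jet are values of sections of twisting order
`e (n + 1)`. -/
theorem mul_mem_sectionSpan {e e' c : ℕ} (he : 1 ≤ e) (hd : e' + e = d) (hc : e * (n + 1) ≤ c)
    {M q : MvPolynomial (Fin (n + 2)) ℂ} (hM : M.IsHomogeneous e') (hq : q.IsHomogeneous e)
    {x : VertCone n d} (hx : IsNondeg x.1) (hqx : jetEval x.1 q = 0) :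
    verticalVec n d (M * q) ∈ sectionSpan c 1 x := by
  -- With p_j of jet ζ^j the Cramer matrix at `x` is the identity, and the family passes through `q`
  -- itself.
  choose p hp hpx using fun j : Fin (n + 1) =>
    hx.exists_form e he (jetMk n (PowerSeries.X ^ (j : ℕ)))
  have h1 : jetMatrix p x.1 = 1 := by
    ext k j
    have := hpx j
    rw [jetEval_apply, jetMk_eq_iff] at this
    rw [jetMatrix, Matrix.of_apply, this k, PowerSeries.coeff_X_pow, Matrix.one_apply]
    simp only [Fin.ext_iff]
  have h2 : jetVector q x.1 = 0 := funext (jetMk_eq_zero_iff.1 hqx)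
  have h3 : cramerForm p q x.1 = q := by
    simp [cramerForm, h1, h2]
  rw [← h3]
  refine verticalVec_mem_sectionSpan hc (fun y => M * cramerForm p q y)
    (isPoly_coeff_mul_left M (isPoly_coeff_cramerForm p q)) (fun y => ?_) (fun y => ?_)
    (fun y f μ => ?_) x
  · have := hM.mul (IsHomogeneous.sub
      ((MvPolynomial.homogeneousSubmodule _ _ e).smul_mem (jetMatrix p y).det hq)
      (MvPolynomial.IsHomogeneous.sum Finset.univ _ e fun j _ =>
        (MvPolynomial.homogeneousSubmodule _ _ e).smul_mem
          ((jetMatrix p y).cramer (jetVector q y) j) (hp j)))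
    rwa [hd] at this
  · rw [map_mul, jetEval_cramerForm, mul_zero]
  · rw [cramerForm_scale hp hq, mul_smul_comm]

/-! ### Products of linear forms through the base point, for n = 1. -/

/-- The value at the base point of the jet of a polynomial. -/
def baseEval (x : Coord n d) (m : MvPolynomial (Fin (n + 2)) ℂ) : ℂ :=
  PowerSeries.coeff 0 (aeval (jetSeries x) m)

theorem baseEval_scale {m : MvPolynomial (Fin (n + 2)) ℂ} (hm : m.IsHomogeneous 1)
    (f : ℂ⟦X⟧) (μ : ℂ) (x : Coord n d) :
    baseEval (scale f μ x) m = PowerSeries.constantCoeff f * baseEval x m := by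
  have := jetEval_scale hm f μ x
  rw [jetEval_apply, jetEval_apply, pow_one, ← map_mul, jetMk_eq_iff] at this
  have h := this 0
  rw [Fin.val_zero, PowerSeries.coeff_zero_eq_constantCoeff_apply (f * _), map_mul,
    ← PowerSeries.coeff_zero_eq_constantCoeff_apply (aeval _ _)] at h
  exact h

/-- Both factors are multiples of ζ on the jet, and ζ² = 0 in the ring of 1-jets. -/
theorem jetEval_mul_eq_zero {x : Coord 1 d} {m₁ m₂ : MvPolynomial (Fin 3) ℂ}
    (h₁ : baseEval x m₁ = 0) (h₂ : baseEval x m₂ = 0) : jetEval x (m₁ * m₂) = 0 := by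
  rw [baseEval] at h₁ h₂
  rw [jetEval_apply, jetMk_eq_zero_iff, map_mul]
  intro k
  rw [PowerSeries.coeff_mul]
  refine Finset.sum_eq_zero fun p hp => ?_
  have hp := Finset.HasAntidiagonal.mem_antidiagonal.1 hp
  have hk := k.2
  obtain h | h : p.1 = 0 ∨ p.2 = 0 := by omega
  · rw [h, h₁, zero_mul]
  · rw [h, h₂, mul_zero]

/-- The multiple of `m` by the value of `l`, minus the multiple of `l` by the value of `m`. -/
def pencilForm (l m : MvPolynomial (Fin (n + 2)) ℂ) (x : Coord n d) :
    MvPolynomial (Fin (n + 2)) ℂ :=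
  baseEval x l • m - baseEval x m • l

theorem baseEval_pencilForm (l m : MvPolynomial (Fin (n + 2)) ℂ) (x : Coord n d) :
    baseEval x (pencilForm l m x) = 0 := by
  simp only [baseEval, pencilForm, map_sub, map_smul, smul_eq_mul]
  ring

theorem pencilForm_scale {l m : MvPolynomial (Fin (n + 2)) ℂ} (hl : l.IsHomogeneous 1)
    (hm : m.IsHomogeneous 1) (f : ℂ⟦X⟧) (μ : ℂ) (x : Coord n d) :
    pencilForm l m (scale f μ x) = PowerSeries.constantCoeff f • pencilForm l m x := by
  rw [pencilForm, baseEval_scale hl, baseEval_scale hm, pencilForm, smul_sub, smul_smul, smul_smul]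

theorem isPoly_coeff_pencilForm (l m : MvPolynomial (Fin (n + 2)) ℂ) (k : Fin (n + 2) →₀ ℕ) :
    IsPolyFun fun x : Coord n d => (pencilForm l m x).coeff k := by
  simp only [pencilForm, MvPolynomial.coeff_sub, MvPolynomial.coeff_smul, smul_eq_mul]
  exact ((isPoly_coeff_aeval l 0).mul (IsPolyFun.const _)).sub
    ((isPoly_coeff_aeval m 0).mul (IsPolyFun.const _))

theorem pencilForm_isHomogeneous {l m : MvPolynomial (Fin (n + 2)) ℂ} (hl : l.IsHomogeneous 1)
    (hm : m.IsHomogeneous 1) (x : Coord n d) : (pencilForm l m x).IsHomogeneous 1 :=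
  IsHomogeneous.sub ((MvPolynomial.homogeneousSubmodule _ _ 1).smul_mem _ hm)
    ((MvPolynomial.homogeneousSubmodule _ _ 1).smul_mem _ hl)

/-- For `1`-jets, multiples of products of two linear forms vanishing at the base point are values
of sections of twisting order `2`. -/
theorem pencilForm_mul_mem_sectionSpan {c e' : ℕ} (hd : e' + 2 = d) (hc : 2 ≤ c)
    {M l m₁ m₂ : MvPolynomial (Fin 3) ℂ} (hM : M.IsHomogeneous e') (hl : l.IsHomogeneous 1)
    (h₁ : m₁.IsHomogeneous 1) (h₂ : m₂.IsHomogeneous 1) (x : VertCone 1 d) :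
    verticalVec 1 d (M * (pencilForm l m₁ x.1 * pencilForm l m₂ x.1)) ∈ sectionSpan c 1 x := by
  refine verticalVec_mem_sectionSpan hc (fun y => M * (pencilForm l m₁ y * pencilForm l m₂ y))
    (isPoly_coeff_mul_left M fun k => ?_) (fun y => ?_) (fun y => ?_) (fun y f μ => ?_) x
  · simp only [MvPolynomial.coeff_mul]
    exact IsPolyFun.sum fun p _ =>
      (isPoly_coeff_pencilForm l m₁ p.1).mul (isPoly_coeff_pencilForm l m₂ p.2)
  · have := hM.mul ((pencilForm_isHomogeneous hl h₁ y).mul (pencilForm_isHomogeneous hl h₂ y))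
    rwa [hd] at this
  · rw [map_mul]
    rw [jetEval_mul_eq_zero (baseEval_pencilForm l m₁ y) (baseEval_pencilForm l m₂ y), mul_zero]
  · rw [pencilForm_scale hl h₁, pencilForm_scale hl h₂, smul_mul_smul_comm, mul_smul_comm, sq]

/-! ### Reduction of degree d forms to linear and quadratic relations. -/

/-- A quadratic reduction of products of linear forms reduces every form of degree `k + 1`
to a linear form. -/
theorem exists_linear_reduction {σ : Type*} [Fintype σ] {G : Submodule ℂ (MvPolynomial σ ℂ)}
    {l : MvPolynomial σ ℂ} {d : ℕ} (hl : l.IsHomogeneous 1)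
    (hG : ∀ m₁ m₂ : MvPolynomial σ ℂ, m₁.IsHomogeneous 1 → m₂.IsHomogeneous 1 →
      ∃ m : MvPolynomial σ ℂ, m.IsHomogeneous 1 ∧ ∀ (e' : ℕ) (M : MvPolynomial σ ℂ), e' + 2 = d →
        M.IsHomogeneous e' → M * (m₁ * m₂ - l * m) ∈ G) (k : ℕ) :
    ∀ P : MvPolynomial σ ℂ, P.IsHomogeneous (k + 1) →
      ∃ m : MvPolynomial σ ℂ, m.IsHomogeneous 1 ∧ ∀ (e' : ℕ) (M : MvPolynomial σ ℂ),
        e' + (k + 1) = d → M.IsHomogeneous e' → M * (P - l ^ k * m) ∈ G := by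
  induction k with
  | zero =>
    intro P hP
    exact ⟨P, by simpa using hP, fun e' M _ _ => by simp⟩
  | succ k ih =>
    intro P hP
    choose m hm hmG using fun i => ih (pderiv i P) (hP.pderiv (i := i))
    choose m' hm' hmG' using fun i => hG (MvPolynomial.X i) (m i) (MvPolynomial.isHomogeneous_X _ i)
      (hm i)
    refine ⟨((k + 2 : ℕ) : ℂ)⁻¹ • ∑ i, m' i, (MvPolynomial.homogeneousSubmodule _ _ 1).smul_mem _
      (MvPolynomial.IsHomogeneous.sum _ _ _ fun i _ => hm' i), fun e' M he hM => ?_⟩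
    have hk : ((k + 2 : ℕ) : ℂ) ≠ 0 := Nat.cast_ne_zero.2 (by omega)
    -- Euler's identity: each partial derivative is reduced by induction to l^k m_i, and then X_i
    -- m_i by the quadratic hypothesis.
    have hPs : P = ((k + 2 : ℕ) : ℂ)⁻¹ • ∑ i, MvPolynomial.X i * pderiv i P := by
      rw [hP.sum_X_mul_pderiv, ← Nat.cast_smul_eq_nsmul ℂ, smul_smul, inv_mul_cancel₀ hk, one_smul]
    have hsum : M * (P - l ^ (k + 1) * ((k + 2 : ℕ) : ℂ)⁻¹ • ∑ i, m' i) =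
        ((k + 2 : ℕ) : ℂ)⁻¹ • ∑ i, ((M * MvPolynomial.X i) * (pderiv i P - l ^ k * m i) +
          (M * l ^ k) * (MvPolynomial.X i * m i - l * m' i)) := by
      conv_lhs => rw [hPs]
      rw [mul_smul_comm, ← smul_sub, mul_smul_comm, Finset.mul_sum, ← Finset.sum_sub_distrib,
        Finset.mul_sum]
      congr 1
      exact Finset.sum_congr rfl fun i _ => by ring
    rw [hsum]
    refine G.smul_mem _ (G.sum_mem fun i _ => G.add_mem ?_ ?_)
    · exact hmG i (e' + 1) _ (by omega) (hM.mul (MvPolynomial.isHomogeneous_X _ i))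
    · refine hmG' i (e' + k) _ (by omega) ?_
      have := hM.mul (hl.pow k)
      rwa [one_mul] at this

/-- For n = 1 the two sides are 4 and 3, which forces a separate treatment of quadrics there. -/
theorem two_mul_le_poleOrder (hn : 2 ≤ n) : 2 * (n + 1) ≤ poleOrder n := by
  rw [poleOrder, Nat.le_div_iff_mul_le two_pos]
  nlinarith

theorem succ_le_poleOrder (hn : 1 ≤ n) : n + 1 ≤ poleOrder n := by
  rw [poleOrder, Nat.le_div_iff_mul_le two_pos]
  nlinarith

/-- Vertical tangent vectors at a nondegenerate jet are combinations of values of sections. -/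
theorem verticalVec_mem_sectionSpan_of_jetEval_eq_zero (hn : 1 ≤ n) (hd : 2 ≤ d) {x : VertCone n d}
    (hx : IsNondeg x.1) {P : MvPolynomial (Fin (n + 2)) ℂ} (hP : P.IsHomogeneous d)
    (hPx : jetEval x.1 P = 0) : verticalVec n d P ∈ sectionSpan (poleOrder n) 1 x := by
  obtain ⟨l, hl, hlx⟩ := hx.exists_form 1 le_rfl 1
  have hlin : ∀ (e' : ℕ) (M m : MvPolynomial (Fin (n + 2)) ℂ), e' + 1 = d → M.IsHomogeneous e' →
      m.IsHomogeneous 1 → jetEval x.1 m = 0 →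
      verticalVec n d (M * m) ∈ sectionSpan (poleOrder n) 1 x := fun e' M m he hM hm hmx =>
    mul_mem_sectionSpan le_rfl he (by rw [one_mul]; exact succ_le_poleOrder hn) hM hm hx hmx
  -- Intersecting with the kernel of evaluation records that the reduction preserves the jet; this
  -- is used at the end to see that the linear factor vanishes on it.
  have hquad : ∀ m₁ m₂ : MvPolynomial (Fin (n + 2)) ℂ, m₁.IsHomogeneous 1 → m₂.IsHomogeneous 1 →
      ∃ m : MvPolynomial (Fin (n + 2)) ℂ, m.IsHomogeneous 1 ∧
        ∀ (e' : ℕ) (M : MvPolynomial (Fin (n + 2)) ℂ), e' + 2 = d → M.IsHomogeneous e' →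
        M * (m₁ * m₂ - l * m) ∈ (sectionSpan (poleOrder n) 1 x).comap (verticalVec n d) ⊓
          LinearMap.ker (jetEval x.1).toLinearMap := by
    intro m₁ m₂ h₁ h₂
    obtain ⟨m, hm, hmx⟩ := hx.exists_form 1 le_rfl (jetEval x.1 (m₁ * m₂))
    have hq : jetEval x.1 (m₁ * m₂ - l * m) = 0 := by
      rw [map_sub, map_mul _ l, hlx, one_mul, hmx, sub_self]
    refine ⟨m, hm, fun e' M he hM => ⟨?_, ?_⟩⟩
    swap
    · show jetEval x.1 _ = 0
      rw [map_mul, hq, mul_zero]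
    show verticalVec n d _ ∈ sectionSpan (poleOrder n) 1 x
    -- For n = 1 the quadric is a product of two pencil forms plus l r, with r a linear form that
    -- vanishes on the jet because l has jet 1. For n ≥ 2 Cramer's rule applies to the quadric
    -- directly.
    rcases hn.eq_or_lt with rfl | hn
    · have hl0 : baseEval x.1 l = 1 := by
        rw [← map_one (jetMk 1), jetEval_apply, jetMk_eq_iff] at hlx
        simpa [baseEval] using hlx 0
      set a₁ := baseEval x.1 m₁
      set a₂ := baseEval x.1 m₂
      have hp₁ : pencilForm l m₁ x.1 = m₁ - a₁ • l := by rw [pencilForm, hl0, one_smul]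
      have hp₂ : pencilForm l m₂ x.1 = m₂ - a₂ • l := by rw [pencilForm, hl0, one_smul]
      have hM' : (M * l).IsHomogeneous (e' + 1) := hM.mul hl
      have hpm := pencilForm_mul_mem_sectionSpan he (c := poleOrder 1) (by decide) hM hl h₁ h₂ x
      set r := a₂ • m₁ + a₁ • m₂ - (a₁ * a₂) • l - m
      have hr : r.IsHomogeneous 1 := by
        refine IsHomogeneous.sub (IsHomogeneous.sub (IsHomogeneous.add ?_ ?_) ?_) hm <;>
        exact (MvPolynomial.homogeneousSubmodule _ _ 1).smul_mem _ (by assumption)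
      have hdec : m₁ * m₂ - l * m = pencilForm l m₁ x.1 * pencilForm l m₂ x.1 + l * r := by
        rw [hp₁, hp₂]
        simp only [r, MvPolynomial.smul_eq_C_mul, map_mul]
        ring
      have hpz : jetEval x.1 (pencilForm l m₁ x.1 * pencilForm l m₂ x.1) = 0 :=
        jetEval_mul_eq_zero (baseEval_pencilForm l m₁ x.1) (baseEval_pencilForm l m₂ x.1)
      have hrx : jetEval x.1 r = 0 := by
        rwa [hdec, map_add, hpz, zero_add, map_mul, hlx, one_mul] at hq
      rw [hdec, mul_add, map_add, ← mul_assoc M l r]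
      exact Submodule.add_mem _ hpm (hlin (e' + 1) _ r (by omega) hM' hr hrx)
    · refine mul_mem_sectionSpan (e := 2) (by norm_num) he (two_mul_le_poleOrder hn) hM ?_ hx hq
      exact (h₁.mul h₂).sub (hl.mul hm)
  obtain ⟨e, rfl⟩ : ∃ e, d = e + 1 := ⟨d - 1, by omega⟩
  obtain ⟨m, hm, hmG⟩ := exists_linear_reduction hl hquad e P hP
  have h1 := hmG 0 1 (by omega) (MvPolynomial.isHomogeneous_one _ _)
  rw [one_mul] at h1
  obtain ⟨h1, h2⟩ := h1
  have h2 : jetEval x.1 (P - l ^ e * m) = 0 := h2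
  have h1 : verticalVec n (e + 1) (P - l ^ e * m) ∈ sectionSpan (poleOrder n) 1 x := h1
  have hmx : jetEval x.1 m = 0 := by
    rwa [map_sub, map_mul, map_pow, hlx, one_pow, one_mul, hPx, zero_sub, neg_eq_zero] at h2
  have h3 := hlin e (l ^ e) m rfl (by simpa using hl.pow e) hm hmx
  have := Submodule.add_mem _ h1 h3
  rwa [← map_add, sub_add_cancel] at this

/-! ### Generation at nondegenerate jets. -/

theorem globallyGeneratedAt_of_isNondeg (hn : 1 ≤ n) (hd : 2 ≤ d) {x : VertCone n d}
    (hx : IsNondeg x.1) : GloballyGeneratedAt (poleOrder n) 1 x := by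
  refine globallyGeneratedAt_of_le fun w hw => ?_
  -- Row i of the matrix is a linear form whose jet is the i-th component of `w`, so the linear
  -- field and `w` move the jet in the same way.
  choose g hg using fun i => hx (jetMk n (jetSeries w i))
  have h1 := glField_mem_sectionSpan (by omega) (poleOrder n) (Matrix.of g) x
  have h2 : w - glField d (Matrix.of g) x.1 ∈ tangentCone x.1 :=
    Submodule.sub_mem _ hw (glField_mem_tangentCone (by omega) _ _)
  have h3 : w - glField d (Matrix.of g) x.1 =
      verticalVec n d (hypOf (w - glField d (Matrix.of g) x.1)) := by
    funext j
    rcases j with ⟨i, k⟩ | α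
    · have := hg i
      rw [jetEval_linForm] at this
      simp only [← map_smul] at this
      rw [← map_sum, jetMk_eq_iff] at this
      have h := this k
      rw [coeff_jetSeries, map_sum] at h
      simp only [PowerSeries.coeff_smul, coeff_jetSeries] at h
      rw [verticalVec_inl, Pi.sub_apply, glField_inl, sub_eq_zero, ← h]
      rfl
    · exact (congrFun (coeffVec_hypPoly fun α =>
        (w - glField d (Matrix.of g) x.1) (Sum.inr α)) α).symm
  rw [h3] at h2
  have h4 := verticalVec_mem_sectionSpan_of_jetEval_eq_zero hn hd hx (hypOf_isHomogeneous _)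
    ((verticalVec_mem_tangentCone_iff (hypOf_isHomogeneous _)).1 h2)
  rw [← h3] at h4
  have := Submodule.add_mem _ h4 h1
  rwa [sub_add_cancel] at this

/-! ### Degenerate jets in the affine chart. -/

theorem IsNondeg.of_scale {x : Coord n d} {f : ℂ⟦X⟧} {μ : ℂ}
    (hf : PowerSeries.constantCoeff f ≠ 0) (h : IsNondeg (scale f μ x)) : IsNondeg x := by
  intro r
  obtain ⟨a, ha⟩ := h (jetMk n f * r)
  refine ⟨a, (isUnit_jetMk (n := n) hf).mul_left_cancel ?_⟩
  rw [← ha, jetEval_scale (linForm_isHomogeneous a), pow_one]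

/-- An affine jet with a nonzero Wronskian is nondegenerate. -/
theorem IsAffine.isNondeg {x : Coord n d} (hx : IsAffine x) {r : Fin n → Fin (n + 1)}
    {l : Fin n → Fin n}
    (hdet : (Matrix.of fun i j => jetDeriv x (r i).succ (l j).succ).det ≠ 0) : IsNondeg x := by
  set M : Matrix (Fin n) (Fin n) ℂ := Matrix.of fun i j => jetDeriv x (r i).succ (l j).succ
  -- A repeated derivative order would give equal columns, so `l` is a permutation and every order
  -- from 1 to n occurs.
  have hl : Function.Surjective l := by
    refine Finite.surjective_of_injective fun j j' hj => ?_
    by_contra hne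
    refine hdet (Matrix.det_zero_of_column_eq hne fun i => ?_)
    simp only [M, Matrix.of_apply, hj]
  intro s
  obtain ⟨g, rfl⟩ := jetMk_surjective s
  obtain ⟨b, hb⟩ : ∃ b : Fin n → ℂ, Matrix.vecMul b M = fun j =>
      (Nat.factorial ((l j).succ : Fin (n + 1)) : ℂ) *
        PowerSeries.coeff ((l j).succ : Fin (n + 1)) g := by
    refine ⟨Matrix.vecMul (fun j => (Nat.factorial ((l j).succ : Fin (n + 1)) : ℂ) *
      PowerSeries.coeff ((l j).succ : Fin (n + 1)) g) M⁻¹, ?_⟩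
    rw [Matrix.vecMul_vecMul, Matrix.nonsing_inv_mul _ (isUnit_iff_ne_zero.2 hdet),
      Matrix.vecMul_one]
  -- Coefficients are summed over the fibres of `r`, which avoids proving `r` injective.
  have hsum : ∀ k : Fin (n + 1),
      ∑ s, (∑ i, if r i = s then b i else 0) * x (Sum.inl (s.succ, k)) =
        ∑ i, b i * x (Sum.inl ((r i).succ, k)) := fun k => by
    simp only [Finset.sum_mul]
    rw [Finset.sum_comm]
    simp [ite_mul]
  -- Since Z_0 = 1 on the jet, its coefficient corrects the constant term and leaves the higher
  -- orders alone.
  refine ⟨Fin.cons (PowerSeries.coeff 0 g - ∑ i, b i * x (Sum.inl ((r i).succ, 0)))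
    (fun s => ∑ i, if r i = s then b i else 0), ?_⟩
  rw [jetEval_apply, aeval_linForm, jetMk_eq_iff]
  intro k
  rw [map_sum, Fin.sum_univ_succ]
  simp only [map_smul, smul_eq_mul, coeff_jetSeries, Fin.cons_zero, Fin.cons_succ, hsum, hx.1 k]
  refine Fin.cases ?_ (fun k' => ?_) k
  · simp
  · obtain ⟨j, rfl⟩ := hl k'
    have h := congrFun hb j
    simp only [Matrix.vecMul, dotProduct, M, Matrix.of_apply, jetDeriv, mul_left_comm (b _)] at h
    rw [← Finset.mul_sum] at h
    have h' := mul_left_cancel₀ (Nat.cast_ne_zero.2 (Nat.factorial_ne_zero _)) h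
    simp only [Fin.succ_ne_zero, if_false, mul_zero, zero_add]
    exact h'

/-- Dividing the lift by Z_0(ζ) and the equation by its leading coefficient normalizes the
coordinates; a nonzero Wronskian would then give nondegeneracy. -/
theorem mk_mem_affineBadSet {y : VertCone n d} (h0 : y.1 (Sum.inl (0, 0)) ≠ 0)
    (hlead : y.1 (Sum.inr (leadIdx n d)) ≠ 0) (hy : ¬IsNondeg y.1) :
    VertJet.mk y ∈ affineBadSet n d := by
  have hc : PowerSeries.constantCoeff (jetSeries y.1 0) ≠ 0 := by
    have := coeff_jetSeries y.1 0 0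
    rw [Fin.val_zero, PowerSeries.coeff_zero_eq_constantCoeff_apply] at this
    rwa [this]
  have hf : PowerSeries.constantCoeff (jetSeries y.1 0)⁻¹ ≠ 0 := by
    simpa using hc
  refine ⟨y.scale hf (inv_ne_zero hlead), ?_, ⟨fun k => ?_, ?_⟩, fun r l => ?_⟩
  · exact (Quotient.sound (s := vertSetoid n d) ⟨_, _, hf, inv_ne_zero hlead, rfl⟩).symm
  · show PowerSeries.coeff (k : ℕ) ((jetSeries y.1 0)⁻¹ * jetSeries y.1 0) = _
    rw [PowerSeries.inv_mul_cancel _ hc, PowerSeries.coeff_one]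
    simp only [Fin.ext_iff, Fin.val_zero]
  · exact inv_mul_cancel₀ hlead
  · by_contra hdet
    refine hy (IsNondeg.of_scale hf (IsAffine.isNondeg (x := scale _ _ y.1) ⟨fun k => ?_, ?_⟩ hdet))
    · show PowerSeries.coeff (k : ℕ) ((jetSeries y.1 0)⁻¹ * jetSeries y.1 0) = _
      rw [PowerSeries.inv_mul_cancel _ hc, PowerSeries.coeff_one]
      simp only [Fin.ext_iff, Fin.val_zero]
    · exact inv_mul_cancel₀ hlead

/-! ### Moving degenerate jets into the affine chart. -/

/-- The action of a matrix `h`: the jet is moved by the adjugate of `h`, and the equation of the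
hypersurface is composed with `h`. -/
def move (h : Matrix (Fin (n + 2)) (Fin (n + 2)) ℂ) (x : Coord n d) : Coord n d :=
  Sum.elim (fun p => ∑ j, h.adjugate p.1 j * x (Sum.inl (j, p.2)))
    (coeffVec n d (aeval (fun i => linForm (h i)) (hypOf x)))

theorem move_inl (h : Matrix (Fin (n + 2)) (Fin (n + 2)) ℂ) (x : Coord n d) (i : Fin (n + 2))
    (k : Fin (n + 1)) : move h x (Sum.inl (i, k)) = ∑ j, h.adjugate i j * x (Sum.inl (j, k)) := rfl

theorem move_inr (h : Matrix (Fin (n + 2)) (Fin (n + 2)) ℂ) (x : Coord n d) (α : MultiIdx n d) :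
    move h x (Sum.inr α) = (aeval (fun i => linForm (h i)) (hypOf x)).coeff (idxExp α) := rfl

theorem jetSeries_move (h : Matrix (Fin (n + 2)) (Fin (n + 2)) ℂ) (x : Coord n d)
    (i : Fin (n + 2)) : jetSeries (move h x) i = ∑ j, h.adjugate i j • jetSeries x j := by
  ext k
  rw [map_sum]
  by_cases hk : k < n + 1
  · simp only [jetSeries, PowerSeries.coeff_mk, dif_pos hk, map_smul, smul_eq_mul]
    rfl
  · simp only [jetSeries, PowerSeries.coeff_mk, dif_neg hk, map_smul, smul_zero,
      Finset.sum_const_zero]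

theorem hypOf_move (h : Matrix (Fin (n + 2)) (Fin (n + 2)) ℂ) (x : Coord n d) :
    hypOf (move h x) = aeval (fun i => linForm (h i)) (hypOf x) := by
  refine (congrArg (hypPoly n d) (funext (move_inr h x))).trans (hypPoly_coeffVec ?_)
  have := (hypOf_isHomogeneous x).aeval (fun i => linForm (h i))
    fun i => linForm_isHomogeneous (h i)
  rwa [one_mul] at this

theorem move_one (x : Coord n d) : move 1 x = x := by
  have h1 : ∀ i, linForm ((1 : Matrix (Fin (n + 2)) (Fin (n + 2)) ℂ) i) = MvPolynomial.X i :=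
    fun i => by simp [linForm, Matrix.one_apply, apply_ite MvPolynomial.C, ite_mul]
  funext j
  rcases j with ⟨i, k⟩ | α
  · simp [move_inl, Matrix.one_apply]
  · rw [move_inr]
    simp only [h1]
    rw [show (fun i => (MvPolynomial.X i : MvPolynomial (Fin (n + 2)) ℂ)) = MvPolynomial.X from rfl,
      MvPolynomial.aeval_X_left_apply]
    exact congrFun (coeffVec_hypPoly fun α => x (Sum.inr α)) α

theorem jetEval_move_linForm (h : Matrix (Fin (n + 2)) (Fin (n + 2)) ℂ) (x : Coord n d)
    (a : Fin (n + 2) → ℂ) :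
    jetEval (move h x) (linForm a) = jetEval x (linForm (Matrix.vecMul a h.adjugate)) := by
  simp only [jetEval_linForm, jetSeries_move, map_sum, map_smul, Finset.smul_sum, smul_smul,
    Matrix.vecMul, dotProduct, Finset.sum_smul]
  exact Finset.sum_comm

/-- Since h adj(h) = det h, the new equation on the new jet is F(det h · Z). No inverse is involved,
so singular matrices are allowed. -/
theorem jetEval_move_hypOf (h : Matrix (Fin (n + 2)) (Fin (n + 2)) ℂ) (x : Coord n d) :
    jetEval (move h x) (hypOf (move h x)) =
      algebraMap ℂ (JetRing n) h.det ^ d * jetEval x (hypOf x) := by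
  have h1 : ∀ i, jetEval (move h x) (linForm (h i)) =
      algebraMap ℂ (JetRing n) h.det * jetMk n (jetSeries x i) := fun i => by
    have h2 : Matrix.vecMul (h i) h.adjugate = fun j => if i = j then h.det else 0 := by
      funext j
      have := congrFun (congrFun (Matrix.mul_adjugate h) i) j
      rw [Matrix.smul_apply, Matrix.one_apply, smul_eq_mul, mul_ite, mul_one, mul_zero] at this
      exact this
    rw [jetEval_move_linForm, h2, jetEval_linForm]
    simp only [ite_smul, zero_smul, Finset.sum_ite_eq, Finset.mem_univ, if_true]
    exact Algebra.smul_def h.det (jetMk n (jetSeries x i))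
  rw [hypOf_move, jetEval_eq_aeval x, ← aeval_mul_of_isHomogeneous (hypOf_isHomogeneous x)]
  simp only [← h1]
  have h3 : (jetEval (move h x)).comp (aeval fun i => linForm (h i)) =
      aeval fun i => jetEval (move h x) (linForm (h i)) := by
    ext i
    simp
  exact congrArg (fun φ : MvPolynomial (Fin (n + 2)) ℂ →ₐ[ℂ] JetRing n => φ (hypOf x)) h3

/-- Linear forms on the moved jet are already linear forms on the original one, for every `h`. -/
theorem IsNondeg.of_move {h : Matrix (Fin (n + 2)) (Fin (n + 2)) ℂ} {x : Coord n d}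
    (hx : IsNondeg (move h x)) : IsNondeg x := fun r => by
  obtain ⟨a, ha⟩ := hx r
  exact ⟨_, by rw [← jetEval_move_linForm, ha]⟩

theorem isPoly_coeff_aeval_linForm (P : MvPolynomial (Fin (n + 2)) ℂ) :
    ∀ m, IsPolyFun fun h : Fin (n + 2) × Fin (n + 2) → ℂ =>
      (aeval (fun i => linForm fun j => h (i, j)) P).coeff m := by
  classical
  induction P using MvPolynomial.induction_on with
  | C a => intro m; simpa using IsPolyFun.const _
  | add p q hp hq => intro m; simpa using (hp m).add (hq m)
  | mul_X p i hp =>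
    intro m
    simp only [map_mul, MvPolynomial.aeval_X, MvPolynomial.coeff_mul]
    refine IsPolyFun.sum fun s _ => (hp _).mul ?_
    simp only [linForm, MvPolynomial.coeff_sum, MvPolynomial.coeff_C_mul]
    exact IsPolyFun.sum fun j _ => (IsPolyFun.coord (i, j)).mul (IsPolyFun.const _)

theorem isPoly_move (x : Coord n d) (j : CoordIdx n d) :
    IsPolyFun fun h : Fin (n + 2) × Fin (n + 2) → ℂ => move (Matrix.of fun i l => h (i, l)) x j := by
  rcases j with ⟨i, k⟩ | α
  · simp only [move_inl, Matrix.adjugate_apply]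
    refine IsPolyFun.sum fun j _ => IsPolyFun.mul (IsPolyFun.det fun a b => ?_) (IsPolyFun.const _)
    by_cases hj : a = j
    · subst hj
      simpa only [Matrix.updateRow_self] using IsPolyFun.const _
    · simp only [Matrix.updateRow_ne hj]
      exact IsPolyFun.coord (a, b)
  · exact isPoly_coeff_aeval_linForm (hypOf x) _

/-- The power X_1^d is the only monomial of degree d that does not vanish at the basis vector e_1.
-/
theorem coeff_leadIdx {P : MvPolynomial (Fin (n + 2)) ℂ} (hP : P.IsHomogeneous d) :
    P.coeff (idxExp (leadIdx n d)) = MvPolynomial.eval (Pi.single 1 1) P := by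
  have h1 : idxExp (leadIdx n d) = Finsupp.single 1 d := by
    ext i
    show (Pi.single 1 d : Fin (n + 2) → ℕ) i = _
    rw [Finsupp.single_apply, Pi.single_apply]
    simp only [eq_comm]
  rw [h1, MvPolynomial.eval_eq, Finset.sum_eq_single (Finsupp.single 1 d)]
  · rw [Finset.prod_eq_one, mul_one]
    intro i hi
    have : i = 1 := by
      by_contra h
      exact Finsupp.mem_support_iff.1 hi (Finsupp.single_eq_of_ne h)
    rw [this, Pi.single_eq_same, one_pow]
  · intro m hm hne
    have hdeg : m.degree = d := by
      by_contra h
      exact MvPolynomial.mem_support_iff.1 hm (hP.coeff_eq_zero h)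
    obtain ⟨i, hi, hi1⟩ : ∃ i ∈ m.support, i ≠ 1 := by
      by_contra! h
      refine hne ?_
      have hm1 : m = Finsupp.single 1 (m 1) := by
        ext i
        by_cases hi : i = 1
        · simp [hi]
        · rw [Finsupp.single_eq_of_ne hi]
          by_contra h0
          exact hi (h i (Finsupp.mem_support_iff.2 h0))
      rw [hm1, Finsupp.degree_single] at hdeg
      rw [hm1, hdeg]
    rw [Finset.prod_eq_zero hi, mul_zero]
    rw [Pi.single_eq_of_ne hi1, zero_pow (Finsupp.mem_support_iff.1 hi)]
  · intro h
    rw [MvPolynomial.notMem_support_iff.1 h, zero_mul]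

theorem coeff_zero_aeval_jetSeries (x : Coord n d) (P : MvPolynomial (Fin (n + 2)) ℂ) :
    PowerSeries.coeff 0 (aeval (jetSeries x) P) =
      MvPolynomial.eval (fun i => x (Sum.inl (i, 0))) P := by
  have h : ∀ i, PowerSeries.constantCoeff (jetSeries x i) = x (Sum.inl (i, 0)) := fun i => by
    have := coeff_jetSeries x i 0
    rwa [Fin.val_zero, PowerSeries.coeff_zero_eq_constantCoeff_apply] at this
  simp [h]

theorem eval_aeval_linForm (M : Matrix (Fin (n + 2)) (Fin (n + 2)) ℂ) (v : Fin (n + 2) → ℂ)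
    (P : MvPolynomial (Fin (n + 2)) ℂ) :
    MvPolynomial.eval v (aeval (fun i => linForm (M i)) P) = MvPolynomial.eval (M.mulVec v) P := by
  have h : (MvPolynomial.aeval v).comp (aeval fun i => linForm (M i)) =
      (MvPolynomial.aeval (M.mulVec v) : MvPolynomial (Fin (n + 2)) ℂ →ₐ[ℂ] ℂ) := by
    ext i
    simp [linForm, Matrix.mulVec, dotProduct]
  exact congrArg (fun φ : MvPolynomial (Fin (n + 2)) ℂ →ₐ[ℂ] ℂ => φ P) h

/-- Two linearly independent vectors are the images of the first two basis vectors under an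
invertible matrix. -/
theorem exists_matrix_mulVec_eq {u v : Fin (n + 2) → ℂ} (h : LinearIndependent ℂ ![u, v]) :
    ∃ M : Matrix (Fin (n + 2)) (Fin (n + 2)) ℂ, M.det ≠ 0 ∧
      M.mulVec (Pi.single 0 1) = u ∧ M.mulVec (Pi.single 1 1) = v := by
  have h0 : LinearIndependent ℂ ![(Pi.single 0 1 : Fin (n + 2) → ℂ), Pi.single 1 1] := by
    rw [LinearIndependent.pair_iff]
    intro s t hst
    exact ⟨by simpa using congrFun hst 0, by simpa using congrFun hst 1⟩
  let f := h0.linearCombinationEquiv.symm ≪≫ₗ h.linearCombinationEquiv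
  obtain ⟨g, hg⟩ := Submodule.exists_linearEquiv_restrict_eq f
  have q0 : (h0.linearCombinationEquiv (Finsupp.single 0 1) : Fin (n + 2) → ℂ) = Pi.single 0 1 := by
    simp
  have q1 : (h0.linearCombinationEquiv (Finsupp.single 1 1) : Fin (n + 2) → ℂ) = Pi.single 1 1 := by
    simp
  refine ⟨LinearMap.toMatrix' g.toLinearMap, ?_, ?_, ?_⟩
  · rw [LinearMap.det_toMatrix']
    exact (LinearEquiv.isUnit_det' g).ne_zero
  · rw [LinearMap.toMatrix'_mulVec, ← q0]
    exact (hg _).symm.trans (by simp [f])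
  · rw [LinearMap.toMatrix'_mulVec, ← q1]
    exact (hg _).symm.trans (by simp [f])

/-- By the identity theorem, zeros accumulating at 0 would force g = 0 on all of ℂ. -/
theorem eventually_ne_zero_of_differentiable {g : ℂ → ℂ} (hg : Differentiable ℂ g) (h1 : g 1 ≠ 0) :
    ∀ᶠ t in nhdsWithin (0 : ℂ) {0}ᶜ, g t ≠ 0 := by
  by_contra h
  have ha : AnalyticOnNhd ℂ g Set.univ := fun z _ => hg.analyticAt z
  have := ha.eqOn_zero_of_preconnected_of_frequently_eq_zero isPreconnected_univ (Set.mem_univ 0)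
      (by simpa only [Filter.Frequently] using h)
  exact h1 (this (Set.mem_univ 1))

/-- Every degenerate vertical jet lies in the exceptional set. -/
theorem mk_mem_badSet {x : VertCone n d} (hx : ¬IsNondeg x.1) :
    VertJet.mk x ∈ badSet n d := by
  obtain ⟨i₀, hi₀⟩ := x.2.1
  obtain ⟨α, hα⟩ := x.2.2.1
  set u : Fin (n + 2) → ℂ := fun i => x.1 (Sum.inl (i, 0))
  have hu : MvPolynomial.eval u (hypOf x.1) = 0 := by
    have h := x.2.2.2 0
    rwa [vertEqn, universalSeries_eq, Fin.val_zero, coeff_zero_aeval_jetSeries] at h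
  -- A point off the hypersurface is not proportional to the base point `u` of the jet, which lies
  -- on it.
  obtain ⟨v, hv⟩ : ∃ v, MvPolynomial.eval v (hypOf x.1) ≠ 0 := by
    by_contra! h
    have h0 : hypOf x.1 = 0 := MvPolynomial.funext fun v => by rw [h v, map_zero]
    refine hα ((congrFun (coeffVec_hypPoly fun α => x.1 (Sum.inr α)) α).symm.trans ?_)
    show coeffVec n d (hypOf x.1) α = 0
    rw [h0, map_zero]
    rfl
  have huv : LinearIndependent ℂ ![u, v] := by
    rw [LinearIndependent.pair_iff' fun h => hi₀ (congrFun h i₀)]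
    rintro a rfl
    refine hv ?_
    have := aeval_mul_of_isHomogeneous (hypOf_isHomogeneous x.1) a u
    exact this.trans ((congrArg (a ^ d * ·) hu).trans (mul_zero _))
  obtain ⟨M, hM, hMu, hMv⟩ := exists_matrix_mulVec_eq huv
  -- The line from the identity to M. At t = 1 the base point becomes det M · e_0 and the leading
  -- coefficient F(M e_1) = F(v), so both chart conditions hold.
  set p : ℂ → Fin (n + 2) × Fin (n + 2) → ℂ := fun t q =>
    (1 - t) * (1 : Matrix (Fin (n + 2)) (Fin (n + 2)) ℂ) q.1 q.2 + t * M q.1 q.2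
  have hp : Differentiable ℂ p := by
    rw [differentiable_pi]
    intro q
    fun_prop
  set y : ℂ → Coord n d := fun t => move (Matrix.of fun i l => p t (i, l)) x.1
  have hy : ∀ j, Differentiable ℂ fun t => y t j := fun j =>
    (isPoly_move x.1 j).differentiable.comp hp
  have hy0 : y 0 = x.1 := by
    have : (Matrix.of fun i l => p 0 (i, l)) = 1 := by
      ext i l
      simp [p]
    simp only [y, this, move_one]
  have hM1 : (Matrix.of fun i l => p 1 (i, l)) = M := by
    ext i l
    simp [p]
  have hy1 : y 1 (Sum.inl (0, 0)) ≠ 0 := by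
    simp only [y, hM1, move_inl]
    have h1 : ∑ j, M.adjugate 0 j * x.1 (Sum.inl (j, 0)) = M.adjugate.mulVec u 0 := rfl
    rw [h1, ← hMu, Matrix.mulVec_mulVec, Matrix.adjugate_mul]
    simpa using hM
  have hy1' : y 1 (Sum.inr (leadIdx n d)) ≠ 0 := by
    simp only [y, hM1]
    rwa [move_inr, ← hypOf_move, coeff_leadIdx (hypOf_isHomogeneous _), hypOf_move,
      eval_aeval_linForm, hMv]
  have hev := eventually_ne_zero_of_differentiable
    ((hy (Sum.inl (0, 0))).mul (hy (Sum.inr (leadIdx n d)))) (mul_ne_zero hy1 hy1')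
  have hlim : Filter.Tendsto y (nhdsWithin (0 : ℂ) {0}ᶜ) (nhds x.1) := by
    have : Continuous y := continuous_pi fun j => (hy j).continuous
    rw [← hy0]
    exact this.continuousAt.tendsto.mono_left nhdsWithin_le_nhds
  have hcont : Continuous (VertJet.mk (n := n) (d := d)) := continuous_quot_mk
  refine hcont.closure_preimage_subset (affineBadSet n d) ?_
  refine closure_subtype.2 (mem_closure_of_tendsto hlim (hev.mono fun t ht => ?_))
  have ht0 := left_ne_zero_of_mul ht
  have ht1 := right_ne_zero_of_mul ht
  have hvert : ∀ κ : Fin (n + 1), vertEqn κ (y t) = 0 := by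
    rw [vertEqn_eq_zero_iff, jetEval_move_hypOf, (vertEqn_eq_zero_iff x.1).1 x.2.2.2, mul_zero]
  exact ⟨⟨y t, ⟨0, ht0⟩, ⟨_, ht1⟩, hvert⟩,
    mk_mem_affineBadSet ht0 ht1 fun h => hx h.of_move, rfl⟩

end

theorem mainTheorem2 :
    (∀ n d : ℕ, 1 ≤ n → n < d → ∀ x : VertCone n d, VertJet.mk x ∉ badSet n d →
      SmoothAt x ∧ GloballyGeneratedAt (poleOrder n) 1 x) ∧
    poleOrder 2 = 7 ∧ poleOrder 3 = 12 := by
  refine ⟨fun n d hn hd x hx => ?_, rfl, rfl⟩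
  have h : IsNondeg x.1 := by
    by_contra h
    exact hx (mk_mem_badSet h)
  exact ⟨smoothAt_of_isNondeg (by omega) h, globallyGeneratedAt_of_isNondeg hn (by omega) h⟩
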